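/- Let $k\in\mathbb R$ with $e^k+e^{-k}\in\mathbb Z\setminus\{2\}$, let $G_k$ be the group of matrices $$\begin{pmatrix} e^{kz}&0&0&x\\ 0&e^{-kz}&0&y\\ 0&0&1&z\\ 0&0&0&1\end{pmatrix},\qquad x,y,z\in\mathbb R,$$ let $\Gamma_k\subset G_k$ be a discrete subgroup with compact quotient $N_k=G_k/\Gamma_k$, and let $\alpha,\beta,\gamma$ be the $1$-forms on $N_k$ induced by the right invariant forms $dx-kx\,dz$, $dy+ky\,dz$, $dz$ on $G_k$. Let $n\in\mathbb Z\setminus\{0\}$ and $\lambda\in\mathbb R$, let $M\to N_k$ be a smooth principal $S^1$-bundle ($S^1=\mathbb R/\mathbb Z$) and let $\eta$ be a connection form on $M$ with curvature $d\eta=n\lambda\,\alpha\wedge\beta$ (so the real Chern class of $M$ is $n\lambda[\alpha\wedge\beta]$); the pull-backs of $\alpha,\beta,\gamma$ to $M$ are denoted by the same letters. Put $$\Omega_{(t_1,t_2,t_3)}=t_1\,\alpha\wedge\eta+t_2\,\beta\wedge\gamma+t_3\,(n\lambda\,\alpha\wedge\beta-k\,\gamma\wedge\eta),$$ $$\Omega'_{(s_1,s_2,s_3)}=s_1\,\beta\wedge\eta+s_2\,\alpha\wedge\gamma+s_3\,(n\lambda\,\alpha\wedge\beta+k\,\gamma\wedge\eta).$$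 (i) Let $(t_1,t_2,t_3)\in\mathbb R^3$ and $u\in\mathbb R$ be such that $t_2=e^u$ and $t_1e^{ut}\neq nk\lambda s t_3^2$ for all $s,t\in[0,1]$. Then there are diffeomorphisms $\phi_{s,t}$ of $M$ and nowhere vanishing functions $f_{s,t}$ on $M$, depending smoothly on $(s,t)\in[0,1]^2$, such that $\phi_{0,0}=\mathrm{id}$ and $$\phi_{s,t}^*\,\Omega_{(t_1,e^{ut},st_3)}=f_{s,t}\,(t_1\,\alpha\wedge\eta+\beta\wedge\gamma)\qquad\text{for all } s,t\in[0,1].$$ In particular $\phi_{1,1}^*\,\Omega_{(t_1,t_2,t_3)}=f_{1,1}\,(t_1\,\alpha\wedge\eta+\beta\wedge\gamma)$, where $\phi_{1,1}$ is smoothly isotopic to the identity through the $\phi_{t,t}$. (ii) Let $(s_1,s_2,s_3)\in\mathbb R^3$ and $u\in\mathbb R$ be such that $s_2=e^u$ and $s_1e^{ut}\neq nk\lambda s s_3^2$ for all $s,t\in[0,1]$. Then there are diffeomorphisms $\phi_{s,t}$ of $M$ and nowhere vanishing functions $f_{s,t}$ on $M$, depending smoothly on $(s,t)\in[0,1]^2$,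 such that $\phi_{0,0}=\mathrm{id}$ and $$\phi_{s,t}^*\,\Omega'_{(s_1,e^{ut},ss_3)}=f_{s,t}\,(s_1\,\beta\wedge\eta+\alpha\wedge\gamma)\qquad\text{for all } s,t\in[0,1].$$ In particular $\phi_{1,1}^*\,\Omega'_{(s_1,s_2,s_3)}=f_{1,1}\,(s_1\,\beta\wedge\eta+\alpha\wedge\gamma)$. -/

import Mathlib

open scoped Manifold ContDiff Topology

noncomputable section

/-! ### Differential forms of degree one and two on manifolds modelled on `ℝ^d` -/

section Forms

variable {d e : ℕ}

/-- Differential `1`-forms (not necessarily smooth) on a `d`-dimensional manifold. -/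
abbrev OneForm (d : ℕ) (M : Type*) [TopologicalSpace M]
    [ChartedSpace (EuclideanSpace ℝ (Fin d)) M] : Type _ :=
  ∀ p : M, TangentSpace (𝓡 d) p →L[ℝ] ℝ

/-- Fields of bilinear forms on the tangent spaces of a `d`-dimensional manifold. Differential
`2`-forms are regarded as such fields. -/
abbrev TwoForm (d : ℕ) (M : Type*) [TopologicalSpace M]
    [ChartedSpace (EuclideanSpace ℝ (Fin d)) M] : Type _ :=
  ∀ p : M, LinearMap.BilinForm ℝ (TangentSpace (𝓡 d) p)

variable {M : Type*} [TopologicalSpace M] [ChartedSpace (EuclideanSpace ℝ (Fin d)) M]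
  {N : Type*} [TopologicalSpace N] [ChartedSpace (EuclideanSpace ℝ (Fin e)) N]

/-- The wedge product `(a ∧ b)(v, w) = a v * b w - b v * a w` of two `1`-forms. -/
def OneForm.wedge (a b : OneForm d M) : TwoForm d M := fun p =>
  LinearMap.BilinForm.linMulLin (a p : TangentSpace (𝓡 d) p →ₗ[ℝ] ℝ) (b p) -
    LinearMap.BilinForm.linMulLin (b p : TangentSpace (𝓡 d) p →ₗ[ℝ] ℝ) (a p)

/-- Pull-back of a `1`-form. -/
def OneForm.pullback (f : M → N) (a : OneForm e N) : OneForm d M := fun p =>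
  (a (f p)).comp (mfderiv (𝓡 d) (𝓡 e) f p)

/-- Pull-back of a `2`-form. -/
def TwoForm.pullback (f : M → N) (Ω : TwoForm e N) : TwoForm d M := fun p =>
  (Ω (f p)).comp (mfderiv (𝓡 d) (𝓡 e) f p : TangentSpace (𝓡 d) p →ₗ[ℝ] _)
    (mfderiv (𝓡 d) (𝓡 e) f p : TangentSpace (𝓡 d) p →ₗ[ℝ] _)

/-- A `1`-form is smooth if it is a smooth section of the cotangent bundle. -/
def OneForm.IsSmooth [IsManifold (𝓡 d) ∞ M] (a : OneForm d M) : Prop :=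
  ContMDiff (𝓡 d) ((𝓡 d).prod 𝓘(ℝ, EuclideanSpace ℝ (Fin d) →L[ℝ] ℝ)) ∞
    (fun p : M => Bundle.TotalSpace.mk' (EuclideanSpace ℝ (Fin d) →L[ℝ] ℝ)
      (E := fun p : M => TangentSpace (𝓡 d) p →L[ℝ] Bundle.Trivial M ℝ p) p (a p))

/-- The `1`-form `a` read in the preferred chart around `p`. -/
def OneForm.inChart (a : OneForm d M) (p : M) (y : EuclideanSpace ℝ (Fin d)) :
    EuclideanSpace ℝ (Fin d) →L[ℝ] ℝ :=
  (a ((extChartAt (𝓡 d) p).symm y)).comp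
    (mfderiv 𝓘(ℝ, EuclideanSpace ℝ (Fin d)) (𝓡 d) (extChartAt (𝓡 d) p).symm y)

/-- The exterior derivative of a `1`-form, computed at `p` in the preferred chart around `p`:
if `a = ∑ aⱼ dxⱼ` then `da = ∑ (∂ᵢ aⱼ) dxᵢ ∧ dxⱼ`. -/
def OneForm.extDeriv (a : OneForm d M) : TwoForm d M := fun p =>
  let D := fderiv ℝ (a.inChart p) (extChartAt (𝓡 d) p p)
  let ψ : TangentSpace (𝓡 d) p →L[ℝ] EuclideanSpace ℝ (Fin d) :=
    mfderiv (𝓡 d) 𝓘(ℝ, EuclideanSpace ℝ (Fin d)) (extChartAt (𝓡 d) p) p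
  LinearMap.mk₂ ℝ (fun v w => D (ψ v) (ψ w) - D (ψ w) (ψ v))
    (fun _ _ _ => by simp; ring) (fun _ _ _ => by simp; ring)
    (fun _ _ _ => by simp; ring) (fun _ _ _ => by simp; ring)

end Forms

/-! ### The solvable group -/

/-- The group of matrices
`[[e^{kz}, 0, 0, x], [0, e^{-kz}, 0, y], [0, 0, 1, z], [0, 0, 0, 1]]`, given by the global
coordinates `(x, y, z)`. -/
def SolGroup (_k : ℝ) : Type := EuclideanSpace ℝ (Fin 3)

namespace SolGroup

variable {k : ℝ}

instance : TopologicalSpace (SolGroup k) :=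
  inferInstanceAs (TopologicalSpace (EuclideanSpace ℝ (Fin 3)))

instance : T2Space (SolGroup k) := inferInstanceAs (T2Space (EuclideanSpace ℝ (Fin 3)))

instance : ChartedSpace (EuclideanSpace ℝ (Fin 3)) (SolGroup k) :=
  inferInstanceAs (ChartedSpace (EuclideanSpace ℝ (Fin 3)) (EuclideanSpace ℝ (Fin 3)))

instance : IsManifold (𝓡 3) ∞ (SolGroup k) :=
  inferInstanceAs (IsManifold (𝓡 3) ∞ (EuclideanSpace ℝ (Fin 3)))

/-- The element with coordinates `(x, y, z)`. -/
def mk (x y z : ℝ) : SolGroup k := (!₂[x, y, z] : EuclideanSpace ℝ (Fin 3))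

/-- The coordinate `x`. -/
def x (g : SolGroup k) : ℝ := (show EuclideanSpace ℝ (Fin 3) from g) 0

/-- The coordinate `y`. -/
def y (g : SolGroup k) : ℝ := (show EuclideanSpace ℝ (Fin 3) from g) 1

/-- The coordinate `z`. -/
def z (g : SolGroup k) : ℝ := (show EuclideanSpace ℝ (Fin 3) from g) 2

/-- The matrix with coordinates `(x, y, z)`. -/
def toMatrix (g : SolGroup k) : Matrix (Fin 4) (Fin 4) ℝ :=
  !![Real.exp (k * g.z), 0, 0, g.x;
     0, Real.exp (-(k * g.z)), 0, g.y;
     0, 0, 1, g.z;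
     0, 0, 0, 1]

@[simp] lemma x_mk (a b c : ℝ) : (mk a b c : SolGroup k).x = a := rfl
@[simp] lemma y_mk (a b c : ℝ) : (mk a b c : SolGroup k).y = b := rfl
@[simp] lemma z_mk (a b c : ℝ) : (mk a b c : SolGroup k).z = c := rfl

lemma ext_coords {g h : SolGroup k} (hx : g.x = h.x) (hy : g.y = h.y) (hz : g.z = h.z) :
    g = h := by
  have : ∀ i : Fin 3, (show EuclideanSpace ℝ (Fin 3) from g) i =
      (show EuclideanSpace ℝ (Fin 3) from h) i := by
    intro i
    fin_cases i
    · exact hx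
    · exact hy
    · exact hz
  exact PiLp.ext this

instance : Mul (SolGroup k) :=
  ⟨fun g h => mk (g.x + Real.exp (k * g.z) * h.x) (g.y + Real.exp (-(k * g.z)) * h.y) (g.z + h.z)⟩

instance : One (SolGroup k) := ⟨mk 0 0 0⟩

instance : Inv (SolGroup k) :=
  ⟨fun g => mk (-(Real.exp (-(k * g.z)) * g.x)) (-(Real.exp (k * g.z) * g.y)) (-g.z)⟩

@[simp] lemma x_mul (g h : SolGroup k) : (g * h).x = g.x + Real.exp (k * g.z) * h.x := rfl
@[simp] lemma y_mul (g h : SolGroup k) : (g * h).y = g.y + Real.exp (-(k * g.z)) * h.y := rfl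
@[simp] lemma z_mul (g h : SolGroup k) : (g * h).z = g.z + h.z := rfl
@[simp] lemma x_one : (1 : SolGroup k).x = 0 := rfl
@[simp] lemma y_one : (1 : SolGroup k).y = 0 := rfl
@[simp] lemma z_one : (1 : SolGroup k).z = 0 := rfl
@[simp] lemma x_inv (g : SolGroup k) : (g⁻¹).x = -(Real.exp (-(k * g.z)) * g.x) := rfl
@[simp] lemma y_inv (g : SolGroup k) : (g⁻¹).y = -(Real.exp (k * g.z) * g.y) := rfl
@[simp] lemma z_inv (g : SolGroup k) : (g⁻¹).z = -g.z := rfl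

instance : Group (SolGroup k) := Group.ofLeftAxioms
  (fun a b c => ext_coords
    (by simp only [x_mul, z_mul, mul_add, Real.exp_add]; ring)
    (by simp only [y_mul, z_mul, mul_add, neg_add, Real.exp_add]; ring)
    (by simp only [z_mul]; ring))
  (fun a => ext_coords (by simp) (by simp) (by simp))
  (fun a => ext_coords (by simp) (by simp) (by simp))

/-- The group law is multiplication of matrices. -/
lemma toMatrix_mul (g h : SolGroup k) : (g * h).toMatrix = g.toMatrix * h.toMatrix := by
  ext i j
  fin_cases i <;> fin_cases j <;>
    simp [toMatrix, Matrix.mul_apply, Fin.sum_univ_four, mul_add, Real.exp_add] <;> ring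

lemma toMatrix_injective : Function.Injective (toMatrix (k := k)) := fun g h H =>
  ext_coords (by simpa [toMatrix] using congrFun (congrFun H 0) 3)
    (by simpa [toMatrix] using congrFun (congrFun H 1) 3)
    (by simpa [toMatrix] using congrFun (congrFun H 2) 3)

lemma continuous_x : Continuous (x (k := k)) := PiLp.continuous_apply 2 _ (0 : Fin 3)
lemma continuous_y : Continuous (y (k := k)) := PiLp.continuous_apply 2 _ (1 : Fin 3)
lemma continuous_z : Continuous (z (k := k)) := PiLp.continuous_apply 2 _ (2 : Fin 3)

lemma continuous_mk {X : Type*} [TopologicalSpace X] {a b c : X → ℝ} (ha : Continuous a)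
    (hb : Continuous b) (hc : Continuous c) :
    Continuous (fun t => (mk (a t) (b t) (c t) : SolGroup k)) := by
  refine (PiLp.continuous_toLp 2 (fun _ : Fin 3 => ℝ)).comp (continuous_pi fun i => ?_)
  fin_cases i
  · exact ha
  · exact hb
  · exact hc

instance : IsTopologicalGroup (SolGroup k) where
  continuous_mul := by
    have hx := continuous_x (k := k)
    have hy := continuous_y (k := k)
    have hz := continuous_z (k := k)
    exact continuous_mk (by fun_prop) (by fun_prop) (by fun_prop)
  continuous_inv := by
    have hx := continuous_x (k := k)
    have hy := continuous_y (k := k)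
    have hz := continuous_z (k := k)
    exact continuous_mk (by fun_prop) (by fun_prop) (by fun_prop)

/-- The coordinate differential `dxᵢ`. -/
def coordForm (k : ℝ) (i : Fin 3) : OneForm 3 (SolGroup k) := fun _ =>
  (EuclideanSpace.proj i : EuclideanSpace ℝ (Fin 3) →L[ℝ] ℝ)

/-- The right invariant `1`-form `dx - k x dz`. -/
def alpha (k : ℝ) : OneForm 3 (SolGroup k) := fun g =>
  coordForm k 0 g - (k * g.x) • coordForm k 2 g

/-- The right invariant `1`-form `dy + k y dz`. -/
def beta (k : ℝ) : OneForm 3 (SolGroup k) := fun g =>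
  coordForm k 1 g + (k * g.y) • coordForm k 2 g

/-- The right invariant `1`-form `dz`. -/
def gamma (k : ℝ) : OneForm 3 (SolGroup k) := coordForm k 2

end SolGroup

/-! ### The quotient by a discrete subgroup -/

namespace SolGroup

variable {k : ℝ} (Γ : Subgroup (SolGroup k))

lemma isLocalHomeomorph_mk [DiscreteTopology Γ] :
    IsLocalHomeomorph (QuotientGroup.mk : SolGroup k → SolGroup k ⧸ Γ) :=
  (Γ.isQuotientCoveringMap ⟨inferInstanceAs (DiscreteTopology Γ)⟩).isCoveringMap.isLocalHomeomorph

/-- The quotient `G ⧸ Γ` (left cosets `gΓ`) by a discrete subgroup is a manifold: the charts are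
the local inverses of the projection `G → G ⧸ Γ`. -/
instance [DiscreteTopology Γ] : ChartedSpace (EuclideanSpace ℝ (Fin 3)) (SolGroup k ⧸ Γ) :=
  (isLocalHomeomorph_mk Γ).chartedSpaceOfRightInverse (g := Quotient.out) QuotientGroup.out_eq'

/-- A local section of the projection `G → G ⧸ Γ`, defined near `c`. -/
def localSection [DiscreteTopology Γ] (c : SolGroup k ⧸ Γ) :
    OpenPartialHomeomorph (SolGroup k ⧸ Γ) (SolGroup k) :=
  (isLocalHomeomorph_mk Γ).localInverseAt c.out

/-- The `1`-form on `G ⧸ Γ` induced by a right invariant `1`-form on `G`: its pull-back under a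
local section of the projection. -/
def descend [DiscreteTopology Γ] (a : OneForm 3 (SolGroup k)) : OneForm 3 (SolGroup k ⧸ Γ) :=
  fun c => OneForm.pullback (localSection Γ c) a c

lemma coe_chartAt [DiscreteTopology Γ] (c : SolGroup k ⧸ Γ) :
    (chartAt (EuclideanSpace ℝ (Fin 3)) c : SolGroup k ⧸ Γ → EuclideanSpace ℝ (Fin 3)) =
      localSection Γ c := rfl

/-- Right translations are smooth. -/
lemma contMDiff_mul_right (h : SolGroup k) : ContMDiff (𝓡 3) (𝓡 3) ∞ (fun g => g * h) := by
  have key : ContDiff ℝ ∞ (fun g : EuclideanSpace ℝ (Fin 3) =>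
      (!₂[g 0 + Real.exp (k * g 2) * h.x, g 1 + Real.exp (-(k * g 2)) * h.y, g 2 + h.z] :
        EuclideanSpace ℝ (Fin 3))) := by
    rw [contDiff_euclidean]
    intro i
    fin_cases i <;> simp <;> fun_prop
  exact key.contMDiff

/-- Two local sections of the projection differ locally by a right translation. -/
lemma eventually_section_eq_mul [DiscreteTopology Γ] {σ : SolGroup k → SolGroup k}
    {g₀ : SolGroup k} (hσ : ContinuousAt σ g₀)
    (h : ∀ᶠ g in 𝓝 g₀, (QuotientGroup.mk (σ g) : SolGroup k ⧸ Γ) = QuotientGroup.mk g) :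
    ∃ b : SolGroup k, ∀ᶠ g in 𝓝 g₀, σ g = g * b := by
  have hc : ContinuousAt (fun g => g⁻¹ * σ g) g₀ := continuousAt_inv.mul hσ
  have hmem : ∀ᶠ g in 𝓝 g₀, g⁻¹ * σ g ∈ Γ := h.mono fun g hg =>
    QuotientGroup.eq.1 hg.symm
  have h0 : g₀⁻¹ * σ g₀ ∈ Γ := hmem.self_of_nhds
  have hd : ({⟨_, h0⟩} : Set Γ) ∈ 𝓝 (⟨_, h0⟩ : Γ) := by simp
  obtain ⟨V, hV, hVΓ⟩ := mem_nhds_subtype _ _ _ |>.1 hd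
  refine ⟨g₀⁻¹ * σ g₀, ?_⟩
  filter_upwards [hmem, hc hV] with g hg hgV
  have : (⟨_, hg⟩ : Γ) = ⟨_, h0⟩ := hVΓ hgV
  have h2 : g⁻¹ * σ g = g₀⁻¹ * σ g₀ := congrArg Subtype.val this
  rw [← h2]
  simp

lemma mk_localSection [DiscreteTopology Γ] {c b : SolGroup k ⧸ Γ}
    (hb : b ∈ (localSection Γ c).source) :
    (QuotientGroup.mk (localSection Γ c b) : SolGroup k ⧸ Γ) = b :=
  (isLocalHomeomorph_mk Γ).apply_localInverseAt_of_mem hb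

lemma mem_localSection_source [DiscreteTopology Γ] (c : SolGroup k ⧸ Γ) :
    c ∈ (localSection Γ c).source := by
  have h := (isLocalHomeomorph_mk Γ).apply_self_mem_localInverseAt_source (x := c.out)
  rwa [QuotientGroup.out_eq'] at h

lemma continuousAt_localSection_mk [DiscreteTopology Γ] {c : SolGroup k ⧸ Γ} {g₀ : SolGroup k}
    (h : (g₀ : SolGroup k ⧸ Γ) ∈ (localSection Γ c).source) :
    ContinuousAt (fun g : SolGroup k => localSection Γ c (g : SolGroup k ⧸ Γ)) g₀ :=
  ((localSection Γ c).continuousAt h).comp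
    (isLocalHomeomorph_mk Γ).continuous.continuousAt

/-- In the global coordinates of the group, a local section of the projection is locally a right
translation. -/
lemma eventually_localSection_mk [DiscreteTopology Γ] {c : SolGroup k ⧸ Γ} {g₀ : SolGroup k}
    (h : (g₀ : SolGroup k ⧸ Γ) ∈ (localSection Γ c).source) :
    ∃ b : SolGroup k, ∀ᶠ g : SolGroup k in 𝓝 g₀,
      localSection Γ c (g : SolGroup k ⧸ Γ) = g * b := by
  refine eventually_section_eq_mul Γ (continuousAt_localSection_mk Γ h) ?_
  filter_upwards [(isLocalHomeomorph_mk Γ).continuous.continuousAt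
    ((localSection Γ c).open_source.mem_nhds h)] with g hg
  exact mk_localSection Γ hg

lemma contMDiffAt_localSection_mk [DiscreteTopology Γ] {c : SolGroup k ⧸ Γ} {g₀ : SolGroup k}
    (h : (g₀ : SolGroup k ⧸ Γ) ∈ (localSection Γ c).source) :
    ContMDiffAt (𝓡 3) (𝓡 3) ∞ (fun g : SolGroup k => localSection Γ c (g : SolGroup k ⧸ Γ)) g₀ := by
  obtain ⟨b, hb⟩ := eventually_localSection_mk Γ h
  exact (contMDiff_mul_right b g₀).congr_of_eventuallyEq hb

instance [DiscreteTopology Γ] : IsManifold (𝓡 3) ∞ (SolGroup k ⧸ Γ) := by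
  refine isManifold_of_contDiffOn (𝓡 3) ∞ _ ?_
  rintro _ _ ⟨c, rfl⟩ ⟨c', rfl⟩
  intro y hy
  have hs : ∀ c : SolGroup k ⧸ Γ, ((localSection Γ c).symm : SolGroup k → SolGroup k ⧸ Γ) =
      QuotientGroup.mk := fun c => (isLocalHomeomorph_mk Γ).localInverseAt_symm c.out
  have hy1 : (localSection Γ c).symm y ∈ (localSection Γ c').source := hy.1.2.1
  rw [hs] at hy1
  have h3 := ContMDiffAt.contDiffAt (contMDiffAt_localSection_mk Γ hy1)
  rw [← hs c] at h3
  exact h3.contDiffWithinAt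

lemma contMDiff_mk [DiscreteTopology Γ] :
    ContMDiff (𝓡 3) (𝓡 3) ∞ (QuotientGroup.mk : SolGroup k → SolGroup k ⧸ Γ) := fun _ =>
  contMDiffAt_iff_target.2 ⟨(isLocalHomeomorph_mk Γ).continuous.continuousAt,
    contMDiffAt_localSection_mk Γ (mem_localSection_source Γ _)⟩

lemma contMDiffAt_localSection [DiscreteTopology Γ] (c : SolGroup k ⧸ Γ) :
    ContMDiffAt (𝓡 3) (𝓡 3) ∞ (localSection Γ c) c :=
  contMDiffAt_extChartAt (I := 𝓡 3) (n := ∞) (x := c)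

/-- For a right invariant form, `descend` is the form whose pull-back to `G` is the given one. -/
lemma pullback_descend [DiscreteTopology Γ] (a : OneForm 3 (SolGroup k))
    (ha : ∀ h : SolGroup k, OneForm.pullback (fun g => g * h) a = a) :
    OneForm.pullback (QuotientGroup.mk : SolGroup k → SolGroup k ⧸ Γ) (descend Γ a) = a := by
  funext g
  obtain ⟨b, hb⟩ := eventually_localSection_mk Γ (mem_localSection_source Γ (g : SolGroup k ⧸ Γ))
  have hcomp := mfderiv_comp g
    ((contMDiffAt_localSection Γ (g : SolGroup k ⧸ Γ)).mdifferentiableAt (by simp))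
    ((contMDiff_mk Γ g).mdifferentiableAt (by simp))
  have hb' : (localSection Γ (g : SolGroup k ⧸ Γ)) ∘ (QuotientGroup.mk) =ᶠ[𝓝 g]
    (fun g => g * b) := hb
  rw [hb'.mfderiv_eq] at hcomp
  have hg : localSection Γ (g : SolGroup k ⧸ Γ) (g : SolGroup k ⧸ Γ) = g * b := hb.self_of_nhds
  have key : ∀ (q : SolGroup k), q = g * b →
      ∀ L : EuclideanSpace ℝ (Fin 3) →L[ℝ] EuclideanSpace ℝ (Fin 3),
      ContinuousLinearMap.comp (a q : EuclideanSpace ℝ (Fin 3) →L[ℝ] ℝ) L =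
        ContinuousLinearMap.comp (a (g * b) : EuclideanSpace ℝ (Fin 3) →L[ℝ] ℝ) L := by
    rintro q rfl L
    rfl
  have h1 := key _ hg (mfderiv (𝓡 3) (𝓡 3) (fun g : SolGroup k => g * b) g)
  have h2 := congrArg (ContinuousLinearMap.comp
    (a (localSection Γ (g : SolGroup k ⧸ Γ) g) : EuclideanSpace ℝ (Fin 3) →L[ℝ] ℝ)) hcomp
  exact (h2.symm.trans h1).trans (congrFun (ha b) g)

/-- The coordinate differentials after a right translation. -/
lemma coordForm_mfderiv_mul_right (g h : SolGroup k) (v : EuclideanSpace ℝ (Fin 3)) :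
    coordForm k 0 (g * h) (mfderiv (𝓡 3) (𝓡 3) (fun g => g * h) g v) =
      v 0 + Real.exp (k * g.z) * (k * v 2) * h.x ∧
    coordForm k 1 (g * h) (mfderiv (𝓡 3) (𝓡 3) (fun g => g * h) g v) =
      v 1 + Real.exp (-(k * g.z)) * (-(k * v 2)) * h.y ∧
    coordForm k 2 (g * h) (mfderiv (𝓡 3) (𝓡 3) (fun g => g * h) g v) = v 2 := by
  let e : EuclideanSpace ℝ (Fin 3) := g
  let F : EuclideanSpace ℝ (Fin 3) → EuclideanSpace ℝ (Fin 3) := fun g =>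
    !₂[g 0 + Real.exp (k * g 2) * h.x, g 1 + Real.exp (-(k * g 2)) * h.y, g 2 + h.z]
  have hF : DifferentiableAt ℝ F e :=
    (ContMDiffAt.contDiffAt (contMDiff_mul_right h g)).differentiableAt (by simp)
  have hm : mfderiv (𝓡 3) (𝓡 3) (fun g : SolGroup k => g * h) g = fderiv ℝ F e :=
    mfderiv_eq_fderiv
  have hp : ∀ i : Fin 3, HasFDerivAt (fun g : EuclideanSpace ℝ (Fin 3) => g i)
      (EuclideanSpace.proj i : EuclideanSpace ℝ (Fin 3) →L[ℝ] ℝ) e := fun i =>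
    (EuclideanSpace.proj i : EuclideanSpace ℝ (Fin 3) →L[ℝ] ℝ).hasFDerivAt
  have hc : ∀ i : Fin 3, HasFDerivAt (fun q => F q i)
      ((EuclideanSpace.proj i : EuclideanSpace ℝ (Fin 3) →L[ℝ] ℝ).comp (fderiv ℝ F e)) e :=
    fun i => (EuclideanSpace.proj i : EuclideanSpace ℝ (Fin 3) →L[ℝ] ℝ).hasFDerivAt.comp
      e hF.hasFDerivAt
  have hmv : ∀ i : Fin 3, coordForm k i (g * h) (mfderiv (𝓡 3) (𝓡 3) (fun g => g * h) g v) =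
      ((EuclideanSpace.proj i : EuclideanSpace ℝ (Fin 3) →L[ℝ] ℝ).comp (fderiv ℝ F e)) v :=
    fun i => congrArg (fun L : EuclideanSpace ℝ (Fin 3) →L[ℝ] EuclideanSpace ℝ (Fin 3) =>
      (EuclideanSpace.proj i : EuclideanSpace ℝ (Fin 3) →L[ℝ] ℝ) (L v)) hm
  refine ⟨(hmv 0).trans ?_, (hmv 1).trans ?_, (hmv 2).trans ?_⟩
  · have h0 := (hc 0).unique ((hp 0).add ((((hp 2).const_mul k).exp).mul_const h.x))
    refine (congrArg (fun L : EuclideanSpace ℝ (Fin 3) →L[ℝ] ℝ => L v) h0).trans ?_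
    simp [z, e]
    ring
  · have h0 := (hc 1).unique ((hp 1).add ((((hp 2).const_mul k).fun_neg.exp).mul_const h.y))
    refine (congrArg (fun L : EuclideanSpace ℝ (Fin 3) →L[ℝ] ℝ => L v) h0).trans ?_
    simp [z, e]
    ring
  · have h0 := (hc 2).unique ((hp 2).add_const h.z)
    exact congrArg (fun L : EuclideanSpace ℝ (Fin 3) →L[ℝ] ℝ => L v) h0

lemma pullback_mul_right_alpha (h : SolGroup k) :
    OneForm.pullback (fun g => g * h) (alpha k) = alpha k := by
  funext g
  refine ContinuousLinearMap.ext fun (v : EuclideanSpace ℝ (Fin 3)) => ?_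
  obtain ⟨h0, h1, h2⟩ := coordForm_mfderiv_mul_right g h v
  refine (congrArg₂ (fun a b => a - (k * (g * h).x) * b) h0 h2).trans ?_
  change _ = v 0 - (k * g.x) * v 2
  rw [x_mul]
  ring

lemma pullback_mul_right_beta (h : SolGroup k) :
    OneForm.pullback (fun g => g * h) (beta k) = beta k := by
  funext g
  refine ContinuousLinearMap.ext fun (v : EuclideanSpace ℝ (Fin 3)) => ?_
  obtain ⟨h0, h1, h2⟩ := coordForm_mfderiv_mul_right g h v
  refine (congrArg₂ (fun a b => a + (k * (g * h).y) * b) h1 h2).trans ?_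
  change _ = v 1 + (k * g.y) * v 2
  rw [y_mul]
  ring

lemma pullback_mul_right_gamma (h : SolGroup k) :
    OneForm.pullback (fun g => g * h) (gamma k) = gamma k := by
  funext g
  refine ContinuousLinearMap.ext fun (v : EuclideanSpace ℝ (Fin 3)) => ?_
  exact (coordForm_mfderiv_mul_right g h v).2.2

end SolGroup

/-! ### Principal circle bundles and connection forms -/

section Bundles

variable {d e : ℕ}

/-- The projection `π : M → N` is a smooth principal bundle with group the circle. -/
structure IsPrincipalCircleBundle
    {M : Type*} [TopologicalSpace M] [ChartedSpace (EuclideanSpace ℝ (Fin d)) M]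
    {N : Type*} [TopologicalSpace N] [ChartedSpace (EuclideanSpace ℝ (Fin e)) N]
    [MulAction Circle M] (π : M → N) : Prop where
  contMDiff_smul :
    ContMDiff ((𝓡 1).prod (𝓡 d)) (𝓡 d) ∞ (fun q : Circle × M => q.1 • q.2)
  proj_smul : ∀ (ζ : Circle) (p : M), π (ζ • p) = π p
  /-- Around every point of the base there is a smooth equivariant local trivialization. -/
  exists_trivialization : ∀ b : N, ∃ τ : Bundle.Trivialization Circle π,
    b ∈ τ.baseSet ∧
    ContMDiffOn (𝓡 d) ((𝓡 e).prod (𝓡 1)) ∞ τ τ.source ∧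
    ContMDiffOn ((𝓡 e).prod (𝓡 1)) (𝓡 d) ∞ τ.toOpenPartialHomeomorph.symm τ.target ∧
    ∀ (ζ : Circle), ∀ p ∈ τ.source, (τ (ζ • p)).2 = ζ * (τ p).2

/-- Connection forms for an action of the circle `ℝ / ℤ ≅ Circle`, `τ ↦ exp (2πiτ)`: smooth
invariant `1`-forms which take the value `1` on the fundamental vector field `d/dτ` of the
action. -/
structure IsConnectionForm
    {M : Type*} [TopologicalSpace M] [ChartedSpace (EuclideanSpace ℝ (Fin d)) M]
    [IsManifold (𝓡 d) ∞ M] [MulAction Circle M] (η : OneForm d M) : Prop where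
  smooth : η.IsSmooth
  invariant : ∀ ζ : Circle, OneForm.pullback (fun p : M => ζ • p) η = η
  vertical : ∀ p : M, η (Circle.exp (2 * Real.pi * 0) • p)
    (mfderiv 𝓘(ℝ, ℝ) (𝓡 d) (fun τ : ℝ => Circle.exp (2 * Real.pi * τ) • p) 0 (1 : ℝ)) = 1

end Bundles

/-! ### The two families of `2`-forms -/

section Families

variable {d : ℕ} {M : Type*} [TopologicalSpace M] [ChartedSpace (EuclideanSpace ℝ (Fin d)) M]

/-- `t₁ α ∧ η + t₂ β ∧ γ + t₃ (c α ∧ β - k γ ∧ η)`. -/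
def OmegaT (α β γ η : OneForm d M) (c k t₁ t₂ t₃ : ℝ) : TwoForm d M :=
  t₁ • α.wedge η + t₂ • β.wedge γ + t₃ • (c • α.wedge β - k • γ.wedge η)

/-- `s₁ β ∧ η + s₂ α ∧ γ + s₃ (c α ∧ β + k γ ∧ η)`. -/
def OmegaS (α β γ η : OneForm d M) (c k s₁ s₂ s₃ : ℝ) : TwoForm d M :=
  s₁ • β.wedge η + s₂ • α.wedge γ + s₃ • (c • α.wedge β + k • γ.wedge η)

/-- A family of diffeomorphisms `φ_{s,t}` of `M` and a family of nowhere vanishing functions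
`f_{s,t}` on `M`, both depending smoothly on `(s, t) ∈ [0,1]²` (jointly with the point of `M`), with
`φ_{0,0}` the identity. -/
structure IsSmoothIsotopy (φ : ℝ → ℝ → (M ≃ₘ^∞⟮𝓡 d, 𝓡 d⟯ M)) (f : ℝ → ℝ → M → ℝ) : Prop where
  smooth_diffeo : ContMDiffOn (𝓘(ℝ, ℝ × ℝ).prod (𝓡 d)) (𝓡 d) ∞
    (fun q : (ℝ × ℝ) × M => φ q.1.1 q.1.2 q.2) ((Set.Icc 0 1 ×ˢ Set.Icc 0 1) ×ˢ Set.univ)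
  smooth_factor : ContMDiffOn (𝓘(ℝ, ℝ × ℝ).prod (𝓡 d)) 𝓘(ℝ, ℝ) ∞
    (fun q : (ℝ × ℝ) × M => f q.1.1 q.1.2 q.2) ((Set.Icc 0 1 ×ˢ Set.Icc 0 1) ×ˢ Set.univ)
  factor_ne_zero : ∀ s ∈ Set.Icc (0 : ℝ) 1, ∀ t ∈ Set.Icc (0 : ℝ) 1, ∀ p : M, f s t p ≠ 0
  map_zero : φ 0 0 = Diffeomorph.refl (𝓡 d) M ∞

end Families

end

noncomputable section

/-! ### Smooth dependence of integrals on parameters -/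

section ParametricIntegral

variable {E F : Type} [NormedAddCommGroup E] [NormedSpace ℝ E] [ProperSpace E]
  [NormedAddCommGroup F] [NormedSpace ℝ F]

lemma hasFDerivAt_intervalIntegral_of_contDiff {f : E × ℝ → F} (hf : ContDiff ℝ ∞ f) (x₀ : E) :
    HasFDerivAt (fun x => ∫ t in (0 : ℝ)..1, f (x, t))
      (∫ t in (0 : ℝ)..1, (fderiv ℝ f (x₀, t)).comp (ContinuousLinearMap.inl ℝ E ℝ)) x₀ := by
  have hc : Continuous f := hf.continuous
  have hd : Continuous (fun q : E × ℝ => (fderiv ℝ f q).comp (ContinuousLinearMap.inl ℝ E ℝ)) :=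
    (hf.continuous_fderiv (by simp)).clm_comp continuous_const
  obtain ⟨C, hC⟩ := ((isCompact_closedBall x₀ 1).prod
    (isCompact_Icc (a := (0 : ℝ)) (b := 1))).exists_bound_of_continuousOn hd.continuousOn
  refine (intervalIntegral.hasFDerivAt_integral_of_dominated_of_fderiv_le
    (F := fun x t => f (x, t)) (μ := MeasureTheory.volume) (bound := fun _ => C)
    (F' := fun x t => (fderiv ℝ f (x, t)).comp (ContinuousLinearMap.inl ℝ E ℝ))
    (Metric.closedBall_mem_nhds x₀ one_pos) ?_ ?_ ?_ ?_ ?_ ?_)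
  · exact Filter.Eventually.of_forall fun x =>
      (hc.comp (by fun_prop : Continuous fun t : ℝ => (x, t))).aestronglyMeasurable
  · exact (hc.comp (by fun_prop : Continuous fun t : ℝ => (x₀, t))).intervalIntegrable _ _
  · exact (hd.comp (by fun_prop : Continuous fun t : ℝ => (x₀, t))).aestronglyMeasurable
  · refine Filter.Eventually.of_forall fun t ht x hx => hC (x, t) ⟨hx, ?_⟩
    rw [Set.uIoc_of_le zero_le_one] at ht
    exact ⟨ht.1.le, ht.2⟩
  · exact intervalIntegrable_const
  · refine Filter.Eventually.of_forall fun t ht x hx => ?_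
    exact ((hf.differentiable (by simp)) (x, t)).hasFDerivAt.comp x
      (hasFDerivAt_prodMk_left x t)

end ParametricIntegral

/-- Integrals over `[0, 1]` of smooth functions depend smoothly on parameters. -/
lemma contDiff_intervalIntegral_of_contDiff {E F : Type} [NormedAddCommGroup E] [NormedSpace ℝ E]
    [ProperSpace E] [NormedAddCommGroup F] [NormedSpace ℝ F] [CompleteSpace F]
    {f : E × ℝ → F} (hf : ContDiff ℝ ∞ f) :
    ContDiff ℝ ∞ (fun x => ∫ t in (0 : ℝ)..1, f (x, t)) := by
  refine contDiff_infty.2 fun n => ?_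
  induction n generalizing F with
  | zero =>
    exact contDiff_zero.2 (continuous_iff_continuousAt.2 fun x =>
      (hasFDerivAt_intervalIntegral_of_contDiff hf x).continuousAt)
  | succ n ih =>
    refine contDiff_succ_iff_hasFDerivAt.2 ⟨_, ?_, fun x =>
      hasFDerivAt_intervalIntegral_of_contDiff hf x⟩
    exact ih (f := fun q : E × ℝ => (fderiv ℝ f q).comp (ContinuousLinearMap.inl ℝ E ℝ))
      ((hf.fderiv_right (by simp)).clm_comp contDiff_const)

/-- Primitives along a smooth family of curves depend smoothly on all parameters. -/
lemma contDiff_primitive_of_contDiff {E F : Type} [NormedAddCommGroup E] [NormedSpace ℝ E]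
    [ProperSpace E] [NormedAddCommGroup F] [NormedSpace ℝ F] [CompleteSpace F]
    {f : ℝ × E → F} (hf : ContDiff ℝ ∞ f) :
    ContDiff ℝ ∞ (fun q : ℝ × E => ∫ t in (0 : ℝ)..q.1, f (t, q.2)) := by
  have h : (fun q : ℝ × E => ∫ t in (0 : ℝ)..q.1, f (t, q.2)) =
      fun q : ℝ × E => q.1 • ∫ t in (0 : ℝ)..1, f (q.1 * t, q.2) := by
    funext q
    have := intervalIntegral.smul_integral_comp_mul_left (a := 0) (b := 1)
      (fun t => f (t, q.2)) q.1
    simpa using this.symm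
  rw [h]
  refine contDiff_fst.smul (contDiff_intervalIntegral_of_contDiff
    (f := fun q : (ℝ × E) × ℝ => f (q.1.1 * q.2, q.1.2)) ?_)
  exact hf.comp (by fun_prop)

/-! ### Forms in charts -/

section Charts

variable {d : ℕ} {M : Type*} [TopologicalSpace M] [ChartedSpace (EuclideanSpace ℝ (Fin d)) M]

lemma OneForm.IsSmooth.contDiffAt_inChart [IsManifold (𝓡 d) ∞ M] {a : OneForm d M} (ha : a.IsSmooth) (P : M) :
    ContDiffAt ℝ ∞ (a.inChart P) (extChartAt (𝓡 d) P P) := by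
  have h1 := ((contMDiffAt_hom_bundle _).1 (ha P)).2
  have h2 : ContMDiffAt 𝓘(ℝ, EuclideanSpace ℝ (Fin d)) (𝓡 d) ∞ (extChartAt (𝓡 d) P).symm
      (extChartAt (𝓡 d) P P) :=
    (contMDiffOn_extChartAt_symm P).contMDiffAt (extChartAt_target_mem_nhds P)
  have h3 := (ContMDiffAt.comp_of_eq (x := extChartAt (𝓡 d) P P) h1 h2
    (extChartAt_to_inv P)).contDiffAt
  refine h3.congr_of_eventuallyEq ?_
  filter_upwards [extChartAt_target_mem_nhds (I := 𝓡 d) P] with y hy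
  have hs : (extChartAt (𝓡 d) P).symm y ∈ (chartAt (EuclideanSpace ℝ (Fin d)) P).source := by
    have := (extChartAt (𝓡 d) P).map_target hy
    rwa [extChartAt_source] at this
  simp only [Function.comp_def, OneForm.inChart, ContinuousLinearMap.inCoordinates]
  rw [TangentBundle.symmL_trivializationAt hs, (extChartAt (𝓡 d) P).right_inv hy]
  rw [ModelWithCorners.range_eq_univ, mfderivWithin_univ]
  ext v
  simp

variable {E : Type*} [NormedAddCommGroup E] [NormedSpace ℝ E]

/-- The value of a `1`-form on the derivative of a map, computed in a chart. -/
lemma OneForm.apply_mfderiv_eventuallyEq [IsManifold (𝓡 d) ∞ M] (a : OneForm d M) {w : E → M} {x₀ : E}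
    (hw : ContMDiffAt 𝓘(ℝ, E) (𝓡 d) 1 w x₀) :
    ∀ᶠ x in 𝓝 x₀, ∀ e : E, a (w x) (mfderiv 𝓘(ℝ, E) (𝓡 d) w x e) =
      a.inChart (w x₀) (extChartAt (𝓡 d) (w x₀) (w x))
        (fderiv ℝ (fun x => extChartAt (𝓡 d) (w x₀) (w x)) x e) := by
  have hsrc : w x₀ ∈ (extChartAt (𝓡 d) (w x₀)).source := mem_extChartAt_source _
  filter_upwards [hw.continuousAt ((isOpen_extChartAt_source (w x₀)).mem_nhds hsrc),
    (contMDiffAt_iff_contMDiffAt_nhds (by simp)).1 hw] with x hx hwx e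
  have hx' : w x ∈ (extChartAt (𝓡 d) (w x₀)).source := hx
  have hs : w x ∈ (chartAt (EuclideanSpace ℝ (Fin d)) (w x₀)).source := by
    rwa [extChartAt_source] at hx'
  have hdw : MDifferentiableAt 𝓘(ℝ, E) (𝓡 d) w x := hwx.mdifferentiableAt (by simp)
  have hdc := (mdifferentiableAt_extChartAt (I := 𝓡 d) hs).comp x hdw
  have hsymm : MDifferentiableAt 𝓘(ℝ, EuclideanSpace ℝ (Fin d)) (𝓡 d)
      (extChartAt (𝓡 d) (w x₀)).symm (extChartAt (𝓡 d) (w x₀) (w x)) :=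
    ((contMDiffOn_extChartAt_symm (n := ∞) (w x₀)).contMDiffAt
      ((isOpen_extChartAt_target (w x₀)).mem_nhds
        ((extChartAt (𝓡 d) (w x₀)).map_source hx'))).mdifferentiableAt (by simp)
  have hcomp := mfderiv_comp x hsymm hdc
  have heq : (extChartAt (𝓡 d) (w x₀)).symm ∘ (extChartAt (𝓡 d) (w x₀) ∘ w) =ᶠ[𝓝 x] w := by
    filter_upwards [hwx.continuousAt ((isOpen_extChartAt_source (w x₀)).mem_nhds hx')] with y hy
    exact (extChartAt (𝓡 d) (w x₀)).left_inv hy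
  rw [heq.mfderiv_eq] at hcomp
  have key : ∀ q : M, q = w x → ∀ v : EuclideanSpace ℝ (Fin d),
      (a (w x) : EuclideanSpace ℝ (Fin d) →L[ℝ] ℝ) v =
        (a q : EuclideanSpace ℝ (Fin d) →L[ℝ] ℝ) v := by
    rintro q rfl v
    rfl
  refine (key _ ((extChartAt (𝓡 d) (w x₀)).left_inv hx') _).trans ?_
  have hf : mfderiv 𝓘(ℝ, E) 𝓘(ℝ, EuclideanSpace ℝ (Fin d)) (extChartAt (𝓡 d) (w x₀) ∘ w) x =
      fderiv ℝ (fun x => extChartAt (𝓡 d) (w x₀) (w x)) x := mfderiv_eq_fderiv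
  rw [hf] at hcomp
  rw [hcomp]
  rfl

lemma ContMDiffAt.contDiffAt_extChartAt_comp [IsManifold (𝓡 d) ∞ M] {w : E → M} {x₀ : E} {n : WithTop ℕ∞} (hn : n ≤ ∞)
    (hw : ContMDiffAt 𝓘(ℝ, E) (𝓡 d) n w x₀) :
    ContDiffAt ℝ n (fun x => extChartAt (𝓡 d) (w x₀) (w x)) x₀ :=
  (((contMDiffAt_extChartAt (I := 𝓡 d) (n := ∞) (x := w x₀)).of_le hn).comp x₀ hw).contDiffAt

lemma mfderiv_extChartAt_mfderiv [IsManifold (𝓡 d) ∞ M] {w : E → M} {x₀ : E}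
    (hw : MDifferentiableAt 𝓘(ℝ, E) (𝓡 d) w x₀) (e : E) :
    mfderiv (𝓡 d) 𝓘(ℝ, EuclideanSpace ℝ (Fin d)) (extChartAt (𝓡 d) (w x₀)) (w x₀)
      (mfderiv 𝓘(ℝ, E) (𝓡 d) w x₀ e) =
      fderiv ℝ (fun x => extChartAt (𝓡 d) (w x₀) (w x)) x₀ e := by
  have hcomp := mfderiv_comp x₀
    (mdifferentiableAt_extChartAt (I := 𝓡 d) (mem_chart_source _ (w x₀))) hw
  have hf : mfderiv 𝓘(ℝ, E) 𝓘(ℝ, EuclideanSpace ℝ (Fin d)) (extChartAt (𝓡 d) (w x₀) ∘ w) x₀ =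
      fderiv ℝ (fun x => extChartAt (𝓡 d) (w x₀) (w x)) x₀ := mfderiv_eq_fderiv
  rw [← hf, hcomp]
  rfl

/-- A smooth `1`-form evaluated on the derivative of a smooth map along a smooth vector field is
a smooth function. -/
lemma OneForm.IsSmooth.contDiffAt_apply_mfderiv [IsManifold (𝓡 d) ∞ M] {a : OneForm d M} (ha : a.IsSmooth) {w : E → M}
    {x₀ : E} (hw : ContMDiffAt 𝓘(ℝ, E) (𝓡 d) ∞ w x₀) {X : E → E} (hX : ContDiffAt ℝ ∞ X x₀) :
    ContDiffAt ℝ ∞ (fun x => a (w x) (mfderiv 𝓘(ℝ, E) (𝓡 d) w x (X x))) x₀ := by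
  have hW := hw.contDiffAt_extChartAt_comp le_rfl
  have h := ((ha.contDiffAt_inChart (w x₀)).comp x₀ hW).clm_apply
    ((hW.fderiv_right (m := ∞) (by simp)).clm_apply hX)
  exact h.congr_of_eventuallyEq
    ((a.apply_mfderiv_eventuallyEq (hw.of_le (by simp))).mono fun x hx => hx (X x))

/-- Cartan's formula for the exterior derivative of a `1`-form along a surface whose first
coordinate lines are annihilated by the form. -/
lemma OneForm.IsSmooth.hasDerivAt_apply_mfderiv [IsManifold (𝓡 d) ∞ M] {a : OneForm d M} (ha : a.IsSmooth)
    {w : ℝ × ℝ → M} {r u : ℝ} (hw : ContMDiffAt 𝓘(ℝ, ℝ × ℝ) (𝓡 d) ∞ w (r, u))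
    (h0 : ∀ᶠ x in 𝓝 (r, u), a (w x) (mfderiv 𝓘(ℝ, ℝ × ℝ) (𝓡 d) w x ((1, 0) : ℝ × ℝ)) = 0) :
    HasDerivAt
      (fun r' => a (w (r', u)) (mfderiv 𝓘(ℝ, ℝ × ℝ) (𝓡 d) w (r', u) ((0, 1) : ℝ × ℝ)))
      (a.extDeriv (w (r, u)) (mfderiv 𝓘(ℝ, ℝ × ℝ) (𝓡 d) w (r, u) ((1, 0) : ℝ × ℝ))
        (mfderiv 𝓘(ℝ, ℝ × ℝ) (𝓡 d) w (r, u) ((0, 1) : ℝ × ℝ))) r := by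
  set P := w (r, u) with hP
  set W : ℝ × ℝ → EuclideanSpace ℝ (Fin d) := fun x => extChartAt (𝓡 d) P (w x) with hWdef
  have hW : ContDiffAt ℝ ∞ W (r, u) := hw.contDiffAt_extChartAt_comp le_rfl
  have hA := (ha.contDiffAt_inChart P).differentiableAt (by simp)
  have hev := a.apply_mfderiv_eventuallyEq (hw.of_le (by simp : (1 : WithTop ℕ∞) ≤ ∞))
  have hWd : HasFDerivAt W (fderiv ℝ W (r, u)) (r, u) :=
    (hW.differentiableAt (by simp)).hasFDerivAt
  have hWdd : HasFDerivAt (fderiv ℝ W) (fderiv ℝ (fderiv ℝ W) (r, u)) (r, u) :=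
    ((hW.fderiv_right (m := ∞) (by simp)).differentiableAt (by simp)).hasFDerivAt
  have hAW : HasFDerivAt (fun x => a.inChart P (W x))
      ((fderiv ℝ (a.inChart P) (W (r, u))).comp (fderiv ℝ W (r, u))) (r, u) :=
    HasFDerivAt.comp (r, u) (g := a.inChart P) hA.hasFDerivAt hWd
  have hG : ∀ e : ℝ × ℝ, HasFDerivAt (fun x => a.inChart P (W x) (fderiv ℝ W x e)) _ (r, u) :=
    fun e => hAW.clm_apply (hWdd.clm_apply (hasFDerivAt_const e (r, u)))
  have hsymm : IsSymmSndFDerivAt ℝ W (r, u) :=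
    hW.isSymmSndFDerivAt (by
      rw [minSmoothness_of_isRCLikeNormedField]
      exact WithTop.coe_le_coe.2 (le_top : (2 : ℕ∞) ≤ ⊤))
  have hzero : (fun x => a.inChart P (W x) (fderiv ℝ W x ((1, 0) : ℝ × ℝ))) =ᶠ[𝓝 (r, u)]
      fun _ => 0 := by
    filter_upwards [h0, hev] with x hx hx'
    exact (hx' (1, 0)).symm.trans hx
  have hG1 := congrArg (fun L : ℝ × ℝ →L[ℝ] ℝ => L (0, 1))
    ((hG (1, 0)).unique ((hasFDerivAt_const (0 : ℝ) (r, u)).congr_of_eventuallyEq hzero))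
  have hline : HasDerivAt (fun r' : ℝ => (r', u)) ((1, 0) : ℝ × ℝ) r :=
    (hasDerivAt_id r).prodMk (hasDerivAt_const r u)
  have hG2 := (hG (0, 1)).comp_hasDerivAt r hline
  have heq : (fun r' => a (w (r', u)) (mfderiv 𝓘(ℝ, ℝ × ℝ) (𝓡 d) w (r', u) ((0, 1) : ℝ × ℝ)))
      =ᶠ[𝓝 r] ((fun x => a.inChart P (W x) (fderiv ℝ W x ((0, 1) : ℝ × ℝ))) ∘
        fun r' : ℝ => (r', u)) := by
    filter_upwards [hline.continuousAt.tendsto.eventually hev] with r' hr'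
    exact hr' (0, 1)
  refine (hG2.congr_of_eventuallyEq heq).congr_deriv ?_
  have hd : ∀ e : ℝ × ℝ, mfderiv (𝓡 d) 𝓘(ℝ, EuclideanSpace ℝ (Fin d)) (extChartAt (𝓡 d) P) P
      (mfderiv 𝓘(ℝ, ℝ × ℝ) (𝓡 d) w (r, u) e) = fderiv ℝ W (r, u) e :=
    fun e => mfderiv_extChartAt_mfderiv (hw.mdifferentiableAt (by simp)) e
  let D := fderiv ℝ (a.inChart P) (W (r, u))
  refine Eq.trans ?_ (congrArg₂ (fun p q : EuclideanSpace ℝ (Fin d) => D p q - D q p)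
    (hd (1, 0)) (hd (0, 1))).symm
  have hs := hsymm.eq ((1, 0) : ℝ × ℝ) ((0, 1) : ℝ × ℝ)
  simp at hG1
  simp
  rw [hs]
  linarith

end Charts

/-! ### Complete smooth flows -/

section Flows

variable {d : ℕ} {M : Type*} [TopologicalSpace M] [ChartedSpace (EuclideanSpace ℝ (Fin d)) M]

/-- A smooth action of the additive group of real numbers. -/
structure IsSmoothFlow (Ψ : ℝ → M → M) : Prop where
  contMDiff : ContMDiff (𝓘(ℝ, ℝ).prod (𝓡 d)) (𝓡 d) ∞ (fun q : ℝ × M => Ψ q.1 q.2)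
  map_zero : ∀ p, Ψ 0 p = p
  map_add : ∀ r s p, Ψ (r + s) p = Ψ r (Ψ s p)

lemma IsSmoothFlow.contMDiff_apply {Ψ : ℝ → M → M} (hΨ : IsSmoothFlow (d := d) Ψ) (r : ℝ) :
    ContMDiff (𝓡 d) (𝓡 d) ∞ (Ψ r) :=
  hΨ.contMDiff.comp (contMDiff_const.prodMk contMDiff_id)

/-- The diffeomorphisms of a smooth flow. -/
def IsSmoothFlow.diffeo {Ψ : ℝ → M → M} (hΨ : IsSmoothFlow (d := d) Ψ) (r : ℝ) :
    M ≃ₘ^∞⟮𝓡 d, 𝓡 d⟯ M where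
  toFun := Ψ r
  invFun := Ψ (-r)
  left_inv p := by rw [← hΨ.map_add, neg_add_cancel, hΨ.map_zero]
  right_inv p := by rw [← hΨ.map_add, add_neg_cancel, hΨ.map_zero]
  contMDiff_toFun := hΨ.contMDiff_apply r
  contMDiff_invFun := hΨ.contMDiff_apply (-r)

/-- If every point has a neighbourhood on which a vector field has a smooth local flow, defined for
a time which does not depend on the point, then the vector field has a global smooth flow. -/
theorem exists_flow_of_uniform_local_flow [T2Space M] [IsManifold (𝓡 d) ∞ M] {v : ∀ p : M, TangentSpace (𝓡 d) p}
    (hv : ContMDiff (𝓡 d) (𝓡 d).tangent 1 (fun p => (⟨p, v p⟩ : TangentBundle (𝓡 d) M)))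
    {ε : ℝ} (hε : 0 < ε)
    (hloc : ∀ p₀ : M, ∃ (U : Set M) (Φ : ℝ × M → M), IsOpen U ∧ p₀ ∈ U ∧
      ContMDiffOn (𝓘(ℝ, ℝ).prod (𝓡 d)) (𝓡 d) ∞ Φ (Set.Ioo (-ε) ε ×ˢ U) ∧
      ∀ p ∈ U, Φ (0, p) = p ∧ IsMIntegralCurveOn (fun r => Φ (r, p)) v (Set.Ioo (-ε) ε)) :
    ∃ Ψ : ℝ → M → M, IsSmoothFlow (d := d) Ψ ∧ ∀ p, IsMIntegralCurve (fun r => Ψ r p) v := by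
  have : IsManifold (𝓡 d) 1 M := IsManifold.of_le (n := ∞) (by simp)
  have hex : ∀ p : M, ∃ c : ℝ → M, c 0 = p ∧ IsMIntegralCurve c v :=
    exists_isMIntegralCurve_of_isMIntegralCurveOn hv hε fun p => by
      obtain ⟨U, Φ, -, hpU, -, hΦ⟩ := hloc p
      exact ⟨fun r => Φ (r, p), (hΦ p hpU).1, (hΦ p hpU).2⟩
  choose c hc0 hc using hex
  have hadd : ∀ r s p, c p (r + s) = c (c p s) r := by
    intro r s p
    have h1 : IsMIntegralCurve (c p ∘ (· + s)) v := (hc p).comp_add s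
    have := isMIntegralCurve_Ioo_eq_of_contMDiff_boundaryless (t₀ := 0) hv h1 (hc (c p s))
      (by simp [hc0])
    exact congrFun this r
  refine ⟨fun r p => c p r, ⟨?_, hc0, hadd⟩, hc⟩
  have hsmall : ∀ r : ℝ, |r| < ε → ∀ p : M,
      ContMDiffAt (𝓘(ℝ, ℝ).prod (𝓡 d)) (𝓡 d) ∞ (fun q : ℝ × M => c q.2 q.1) (r, p) := by
    intro r hr p
    obtain ⟨U, Φ, hU, hpU, hΦs, hΦ⟩ := hloc p
    have hnhds : Set.Ioo (-ε) ε ×ˢ U ∈ 𝓝 (r, p) :=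
      (isOpen_Ioo.prod hU).mem_nhds ⟨abs_lt.1 hr, hpU⟩
    refine (hΦs.contMDiffAt hnhds).congr_of_eventuallyEq ?_
    filter_upwards [hnhds] with q hq
    exact isMIntegralCurveOn_Ioo_eqOn_of_contMDiff_boundaryless (t₀ := 0)
      ⟨neg_lt_zero.2 hε, hε⟩ hv ((hc q.2).isMIntegralCurveOn _) (hΦ q.2 hq.2).2
      ((hc0 q.2).trans (hΦ q.2 hq.2).1.symm) hq.1
  have hall : ∀ n : ℕ, ∀ r : ℝ, |r| < (n + 1) * ε → ∀ p : M,
      ContMDiffAt (𝓘(ℝ, ℝ).prod (𝓡 d)) (𝓡 d) ∞ (fun q : ℝ × M => c q.2 q.1) (r, p) := by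
    intro n
    induction n with
    | zero => intro r hr; exact hsmall r (by simpa using hr)
    | succ n ih =>
      intro r hr p
      push_cast at hr
      have hn : (0 : ℝ) < n + 1 + 1 := by positivity
      set r₁ : ℝ := r * ((n + 1) / (n + 1 + 1)) with hr₁
      have h1 : |r₁| < (n + 1) * ε := by
        rw [hr₁, abs_mul, abs_of_nonneg (a := ((n : ℝ) + 1) / (n + 1 + 1)) (by positivity),
          mul_div_assoc', div_lt_iff₀ hn]
        nlinarith [(by positivity : (0 : ℝ) < n + 1)]
      have h2 : |r - r₁| < ε := by
        have : r - r₁ = r / (n + 1 + 1) := by rw [hr₁]; field_simp; ring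
        rw [this, abs_div, abs_of_pos hn, div_lt_iff₀ hn]
        linarith
      have hr1 : ContMDiffAt (𝓡 d) (𝓡 d) ∞ (fun p => c p r₁) p :=
        (ih r₁ h1 p).comp p (contMDiffAt_const.prodMk contMDiffAt_id)
      have hin : ContMDiffAt (𝓘(ℝ, ℝ).prod (𝓡 d)) (𝓘(ℝ, ℝ).prod (𝓡 d)) ∞
          (fun q : ℝ × M => (q.1 - r₁, c q.2 r₁)) (r, p) :=
        (contMDiffAt_fst.sub contMDiffAt_const).prodMk
          (hr1.comp (r, p) (contMDiffAt_snd))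
      have := ContMDiffAt.comp (r, p) (hsmall (r - r₁) h2 (c p r₁)) hin
      refine this.congr_of_eventuallyEq (Filter.Eventually.of_forall fun q => ?_)
      change c q.2 q.1 = c (c q.2 r₁) (q.1 - r₁)
      rw [← hadd, sub_add_cancel]
  rintro ⟨r, p⟩
  obtain ⟨n, hn⟩ := exists_nat_gt (|r| / ε)
  exact hall n r (by rw [div_lt_iff₀ hε] at hn; nlinarith) p

end Flows

/-! ### Left translations of the solvable group -/

namespace SolGroup

variable {k : ℝ}

/-- Left translations are smooth. -/
lemma contMDiff_mul_left (h : SolGroup k) : ContMDiff (𝓡 3) (𝓡 3) ∞ (fun g => h * g) := by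
  have key : ContDiff ℝ ∞ (fun g : EuclideanSpace ℝ (Fin 3) =>
      (!₂[h.x + Real.exp (k * h.z) * g 0, h.y + Real.exp (-(k * h.z)) * g 1, h.z + g 2] :
        EuclideanSpace ℝ (Fin 3))) := by
    rw [contDiff_euclidean]
    intro i
    fin_cases i <;> simp <;> fun_prop
  exact key.contMDiff

/-- The coordinate differentials after a left translation. -/
lemma coordForm_mfderiv_mul_left (g h : SolGroup k) (v : EuclideanSpace ℝ (Fin 3)) :
    coordForm k 0 (h * g) (mfderiv (𝓡 3) (𝓡 3) (fun g => h * g) g v) =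
      Real.exp (k * h.z) * v 0 ∧
    coordForm k 1 (h * g) (mfderiv (𝓡 3) (𝓡 3) (fun g => h * g) g v) =
      Real.exp (-(k * h.z)) * v 1 ∧
    coordForm k 2 (h * g) (mfderiv (𝓡 3) (𝓡 3) (fun g => h * g) g v) = v 2 := by
  let e : EuclideanSpace ℝ (Fin 3) := g
  let F : EuclideanSpace ℝ (Fin 3) → EuclideanSpace ℝ (Fin 3) := fun g =>
    !₂[h.x + Real.exp (k * h.z) * g 0, h.y + Real.exp (-(k * h.z)) * g 1, h.z + g 2]
  have hF : DifferentiableAt ℝ F e :=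
    (ContMDiffAt.contDiffAt (contMDiff_mul_left h g)).differentiableAt (by simp)
  have hm : mfderiv (𝓡 3) (𝓡 3) (fun g : SolGroup k => h * g) g = fderiv ℝ F e :=
    mfderiv_eq_fderiv
  have hp : ∀ i : Fin 3, HasFDerivAt (fun g : EuclideanSpace ℝ (Fin 3) => g i)
      (EuclideanSpace.proj i : EuclideanSpace ℝ (Fin 3) →L[ℝ] ℝ) e := fun i =>
    (EuclideanSpace.proj i : EuclideanSpace ℝ (Fin 3) →L[ℝ] ℝ).hasFDerivAt
  have hc : ∀ i : Fin 3, HasFDerivAt (fun q => F q i)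
      ((EuclideanSpace.proj i : EuclideanSpace ℝ (Fin 3) →L[ℝ] ℝ).comp (fderiv ℝ F e)) e :=
    fun i => (EuclideanSpace.proj i : EuclideanSpace ℝ (Fin 3) →L[ℝ] ℝ).hasFDerivAt.comp
      e hF.hasFDerivAt
  have hmv : ∀ i : Fin 3, coordForm k i (h * g) (mfderiv (𝓡 3) (𝓡 3) (fun g => h * g) g v) =
      ((EuclideanSpace.proj i : EuclideanSpace ℝ (Fin 3) →L[ℝ] ℝ).comp (fderiv ℝ F e)) v :=
    fun i => congrArg (fun L : EuclideanSpace ℝ (Fin 3) →L[ℝ] EuclideanSpace ℝ (Fin 3) =>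
      (EuclideanSpace.proj i : EuclideanSpace ℝ (Fin 3) →L[ℝ] ℝ) (L v)) hm
  refine ⟨(hmv 0).trans ?_, (hmv 1).trans ?_, (hmv 2).trans ?_⟩
  · exact congrArg (fun L : EuclideanSpace ℝ (Fin 3) →L[ℝ] ℝ => L v)
      ((hc 0).unique (((hp 0).const_mul (Real.exp (k * h.z))).const_add h.x))
  · exact congrArg (fun L : EuclideanSpace ℝ (Fin 3) →L[ℝ] ℝ => L v)
      ((hc 1).unique (((hp 1).const_mul (Real.exp (-(k * h.z)))).const_add h.y))
  · exact congrArg (fun L : EuclideanSpace ℝ (Fin 3) →L[ℝ] ℝ => L v)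
      ((hc 2).unique ((hp 2).const_add h.z))

lemma pullback_mul_left_alpha (h : SolGroup k) :
    OneForm.pullback (fun g => h * g) (alpha k) =
      Real.exp (k * h.z) • alpha k - (k * h.x) • gamma k := by
  funext g
  refine ContinuousLinearMap.ext fun (v : EuclideanSpace ℝ (Fin 3)) => ?_
  obtain ⟨h0, h1, h2⟩ := coordForm_mfderiv_mul_left g h v
  refine (congrArg₂ (fun a b => a - (k * (h * g).x) * b) h0 h2).trans ?_
  change _ = Real.exp (k * h.z) * (v 0 - (k * g.x) * v 2) - (k * h.x) * v 2
  rw [x_mul]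
  ring

lemma pullback_mul_left_beta (h : SolGroup k) :
    OneForm.pullback (fun g => h * g) (beta k) =
      Real.exp (-(k * h.z)) • beta k + (k * h.y) • gamma k := by
  funext g
  refine ContinuousLinearMap.ext fun (v : EuclideanSpace ℝ (Fin 3)) => ?_
  obtain ⟨h0, h1, h2⟩ := coordForm_mfderiv_mul_left g h v
  refine (congrArg₂ (fun a b => a + (k * (h * g).y) * b) h1 h2).trans ?_
  change _ = Real.exp (-(k * h.z)) * (v 1 + (k * g.y) * v 2) + (k * h.y) * v 2
  rw [y_mul]
  ring

lemma pullback_mul_left_gamma (h : SolGroup k) :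
    OneForm.pullback (fun g => h * g) (gamma k) = gamma k := by
  funext g
  refine ContinuousLinearMap.ext fun (v : EuclideanSpace ℝ (Fin 3)) => ?_
  exact (coordForm_mfderiv_mul_left g h v).2.2

/-- The right invariant vector field whose values under `alpha`, `beta`, `gamma` are `a`, `b`,
`c`. -/
def generator (k a b c : ℝ) (g : EuclideanSpace ℝ (Fin 3)) : EuclideanSpace ℝ (Fin 3) :=
  !₂[a + k * c * g 0, b - k * c * g 1, c]

lemma contDiff_generator (a b c : ℝ) : ContDiff ℝ ∞ (generator k a b c) := by
  unfold generator
  rw [contDiff_euclidean]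
  intro i
  fin_cases i <;> simp <;> fun_prop

lemma alpha_generator (a b c : ℝ) (g : SolGroup k) : alpha k g (generator k a b c g) = a := by
  change (a + k * c * g.x) - k * g.x * c = a
  ring

lemma beta_generator (a b c : ℝ) (g : SolGroup k) : beta k g (generator k a b c g) = b := by
  change (b - k * c * g.y) + k * g.y * c = b
  ring

lemma gamma_generator (a b c : ℝ) (g : SolGroup k) : gamma k g (generator k a b c g) = c := rfl

/-- Left translation by `(r a, r b, r c)`. -/
def translate (k a b c : ℝ) (q : ℝ × EuclideanSpace ℝ (Fin 3)) : EuclideanSpace ℝ (Fin 3) :=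
  !₂[q.1 * a + Real.exp (k * (q.1 * c)) * q.2 0, q.1 * b + Real.exp (-(k * (q.1 * c))) * q.2 1,
    q.1 * c + q.2 2]

lemma translate_eq_mul (a b c r : ℝ) (g : SolGroup k) :
    translate k a b c (r, g) = (mk (r * a) (r * b) (r * c) : SolGroup k) * g := rfl

lemma translate_zero (a b c : ℝ) (g : SolGroup k) : translate k a b c (0, g) = g := by
  have h1 : (mk (0 * a) (0 * b) (0 * c) : SolGroup k) = 1 := ext_coords (by simp) (by simp) (by simp)
  exact (translate_eq_mul a b c 0 g).trans (by rw [h1, one_mul])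

lemma contDiff_translate (a b c : ℝ) : ContDiff ℝ ∞ (translate k a b c) := by
  unfold translate
  rw [contDiff_euclidean]
  intro i
  fin_cases i <;> simp <;> fun_prop

/-- If `(r a, r b, r c)` is a one-parameter group, its left translations are the flow of the
corresponding right invariant vector field. -/
lemma hasDerivAt_translate {a b c : ℝ} (hac : a * c = 0) (hbc : b * c = 0) (r : ℝ)
    (g : EuclideanSpace ℝ (Fin 3)) :
    HasDerivAt (fun r => translate k a b c (r, g))
      (generator k a b c (translate k a b c (r, g))) r := by
  rw [hasDerivAt_iff_hasFDerivAt, ← hasFDerivWithinAt_univ, hasFDerivWithinAt_euclidean]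
  intro i
  rw [hasFDerivWithinAt_univ]
  have hl : ∀ s : ℝ, HasDerivAt (fun r : ℝ => r * s) s r := fun s => by
    simpa using (hasDerivAt_id r).mul_const s
  have he : HasDerivAt (fun r : ℝ => k * (r * c)) (k * c) r := (hl c).const_mul k
  fin_cases i
  · refine (((hl a).add (he.exp.mul_const (g 0))).congr_deriv
      (g' := a + k * c * (r * a + Real.exp (k * (r * c)) * g 0)) ?_).hasFDerivAt.congr_fderiv ?_
    · linear_combination (-(k * r)) * hac
    · ext
      simp [generator, translate]
  · refine (((hl b).add (he.fun_neg.exp.mul_const (g 1))).congr_deriv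
      (g' := b - k * c * (r * b + Real.exp (-(k * (r * c))) * g 1)) ?_).hasFDerivAt.congr_fderiv ?_
    · linear_combination (k * r) * hbc
    · ext
      simp [generator, translate]
  · refine ((hl c).add_const (g 2)).hasFDerivAt.congr_fderiv ?_
    ext
    simp [generator]

end SolGroup

/-! ### Forms on the total space of the bundle -/

lemma OneForm.apply_congr {d : ℕ} {M : Type*} [TopologicalSpace M]
    [ChartedSpace (EuclideanSpace ℝ (Fin d)) M] (a : OneForm d M) {p q : M} (h : p = q)
    (v : EuclideanSpace ℝ (Fin d)) :
    (a p : EuclideanSpace ℝ (Fin d) →L[ℝ] ℝ) v = (a q : EuclideanSpace ℝ (Fin d) →L[ℝ] ℝ) v := by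
  subst h
  rfl

lemma HasDerivAt.mfderiv_apply_one {F : Type*} [NormedAddCommGroup F] [NormedSpace ℝ F] {f : ℝ → F}
    {f' : F} {r : ℝ} (hf : HasDerivAt f f' r) :
    mfderiv 𝓘(ℝ, ℝ) 𝓘(ℝ, F) f r (1 : ℝ) = f' :=
  (congrArg (fun L : ℝ →L[ℝ] F => L 1) (mfderiv_eq_fderiv.trans hf.hasFDerivAt.fderiv)).trans
    (by simp)

namespace IsPrincipalCircleBundle

variable {d e : ℕ} {M : Type*} [TopologicalSpace M] [ChartedSpace (EuclideanSpace ℝ (Fin d)) M]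
  {N : Type*} [TopologicalSpace N] [ChartedSpace (EuclideanSpace ℝ (Fin e)) N]
  [MulAction Circle M] {π : M → N}

lemma contMDiff_proj (hπ : IsPrincipalCircleBundle (d := d) (e := e) π) :
    ContMDiff (𝓡 d) (𝓡 e) ∞ π := by
  intro p
  obtain ⟨τ, hb, hτ, -, -⟩ := hπ.exists_trivialization (π p)
  have hp : p ∈ τ.source := τ.mem_source.2 hb
  have h1 : ContMDiffAt (𝓡 d) ((𝓡 e).prod (𝓡 1)) ∞ τ p := hτ.contMDiffAt (τ.open_source.mem_nhds hp)
  exact (contMDiffAt_fst.comp p h1).congr_of_eventuallyEq (τ.coe_fst_eventuallyEq_proj hp).symm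

lemma contMDiff_exp_smul (hπ : IsPrincipalCircleBundle (d := d) (e := e) π) :
    ContMDiff (𝓘(ℝ, ℝ).prod (𝓡 d)) (𝓡 d) ∞
      (fun q : ℝ × M => Circle.exp (2 * Real.pi * q.1) • q.2) := by
  have h : ContMDiff 𝓘(ℝ, ℝ) (𝓡 1) ∞ (fun t : ℝ => Circle.exp (2 * Real.pi * t)) :=
    contMDiff_circleExp.comp
      (contDiff_const.mul contDiff_id : ContDiff ℝ ∞ fun t : ℝ => 2 * Real.pi * t).contMDiff
  exact hπ.contMDiff_smul.comp ((h.comp contMDiff_fst).prodMk contMDiff_snd)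

end IsPrincipalCircleBundle

section Action

variable {d e : ℕ} {M : Type*} [TopologicalSpace M] [ChartedSpace (EuclideanSpace ℝ (Fin d)) M]
  [IsManifold (𝓡 d) ∞ M]
  {N : Type*} [TopologicalSpace N] [ChartedSpace (EuclideanSpace ℝ (Fin e)) N]
  [MulAction Circle M] {π : M → N} {η : OneForm d M}

/-- A connection form takes the value `1` on the velocity of every orbit of `ℝ / ℤ`. -/
lemma IsConnectionForm.apply_mfderiv_exp_smul (hη : IsConnectionForm η)
    (hπ : IsPrincipalCircleBundle (d := d) (e := e) π) (t : ℝ) (p : M) :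
    η (Circle.exp (2 * Real.pi * t) • p)
      (mfderiv 𝓘(ℝ, ℝ) (𝓡 d) (fun τ : ℝ => Circle.exp (2 * Real.pi * τ) • p) t (1 : ℝ)) = 1 := by
  set q : M := Circle.exp (2 * Real.pi * t) • p with hq
  have hsm : ContMDiff 𝓘(ℝ, ℝ) (𝓡 d) ∞ (fun τ : ℝ => Circle.exp (2 * Real.pi * τ) • q) :=
    hπ.contMDiff_exp_smul.comp (contMDiff_id.prodMk contMDiff_const)
  have hshift : (fun τ : ℝ => Circle.exp (2 * Real.pi * τ) • p) =
      (fun τ : ℝ => Circle.exp (2 * Real.pi * τ) • q) ∘ fun τ => τ - t := by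
    funext τ
    simp only [Function.comp, hq, smul_smul, ← Circle.exp_add]
    congr 2
    ring
  have hd : HasDerivAt (fun τ : ℝ => τ - t) 1 t := (hasDerivAt_id t).sub_const t
  have hcomp := mfderiv_comp_of_eq (x := t) (y := (0 : ℝ)) (f := fun τ : ℝ => τ - t)
    ((hsm 0).mdifferentiableAt (by simp)) hd.differentiableAt.mdifferentiableAt (by simp)
  rw [← hshift] at hcomp
  have h1 : mfderiv 𝓘(ℝ, ℝ) 𝓘(ℝ, ℝ) (fun τ : ℝ => τ - t) t (1 : ℝ) = (1 : ℝ) :=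
    hd.mfderiv_apply_one
  have h2 : mfderiv 𝓘(ℝ, ℝ) (𝓡 d) (fun τ : ℝ => Circle.exp (2 * Real.pi * τ) • p) t (1 : ℝ) =
      mfderiv 𝓘(ℝ, ℝ) (𝓡 d) (fun τ : ℝ => Circle.exp (2 * Real.pi * τ) • q) 0 (1 : ℝ) := by
    let L : ℝ → ℝ →L[ℝ] EuclideanSpace ℝ (Fin d) := fun s =>
      mfderiv 𝓘(ℝ, ℝ) (𝓡 d) (fun τ : ℝ => Circle.exp (2 * Real.pi * τ) • q) s
    refine (congrArg (fun L : ℝ →L[ℝ] EuclideanSpace ℝ (Fin d) => L 1) hcomp).trans ?_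
    exact (congrArg (L (t - t)) h1).trans
      (congrArg (fun s => L s 1) (sub_self t))
  rw [h2]
  exact (η.apply_congr (by simp) _).trans (hη.vertical q)

/-- A connection form on the velocity of a curve which is moved by the action. -/
lemma IsConnectionForm.apply_mfderiv_curve (hη : IsConnectionForm η)
    (hπ : IsPrincipalCircleBundle (d := d) (e := e) π) {θ : ℝ → ℝ} {θ' r : ℝ}
    (hθ : HasDerivAt θ θ' r) {q : ℝ → M} (hq : MDifferentiableAt 𝓘(ℝ, ℝ) (𝓡 d) q r) :
    η (Circle.exp (2 * Real.pi * θ r) • q r)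
      (mfderiv 𝓘(ℝ, ℝ) (𝓡 d) (fun t => Circle.exp (2 * Real.pi * θ t) • q t) r (1 : ℝ)) =
      θ' + η (q r) (mfderiv 𝓘(ℝ, ℝ) (𝓡 d) q r (1 : ℝ)) := by
  let A : ℝ × M → M := fun q => Circle.exp (2 * Real.pi * q.1) • q.2
  have hA : MDifferentiableAt (𝓘(ℝ, ℝ).prod (𝓡 d)) (𝓡 d) A (θ r, q r) :=
    (hπ.contMDiff_exp_smul _).mdifferentiableAt (by simp)
  have hθm : MDifferentiableAt 𝓘(ℝ, ℝ) 𝓘(ℝ, ℝ) θ r := hθ.differentiableAt.mdifferentiableAt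
  have hcomp := mfderiv_comp r hA (hθm.prodMk hq)
  have hpair := hθm.mfderiv_prod hq
  have hθ1 : mfderiv 𝓘(ℝ, ℝ) 𝓘(ℝ, ℝ) θ r (1 : ℝ) = θ' :=
    hθ.mfderiv_apply_one
  have hval : mfderiv 𝓘(ℝ, ℝ) (𝓡 d) (fun t => Circle.exp (2 * Real.pi * θ t) • q t) r (1 : ℝ) =
      mfderiv 𝓘(ℝ, ℝ) (𝓡 d) (fun τ : ℝ => Circle.exp (2 * Real.pi * τ) • q r) (θ r) θ' +
      mfderiv (𝓡 d) (𝓡 d) (fun p : M => Circle.exp (2 * Real.pi * θ r) • p) (q r)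
        (mfderiv 𝓘(ℝ, ℝ) (𝓡 d) q r (1 : ℝ)) := by
    rw [← hθ1]
    have h3 := mfderiv_prod_eq_add_apply (v := ((mfderiv 𝓘(ℝ, ℝ) 𝓘(ℝ, ℝ) θ r (1 : ℝ),
      mfderiv 𝓘(ℝ, ℝ) (𝓡 d) q r (1 : ℝ)) : TangentSpace (𝓘(ℝ, ℝ).prod (𝓡 d)) (θ r, q r))) hA
    refine Eq.trans ?_ h3
    refine (congrArg (fun L : ℝ →L[ℝ] EuclideanSpace ℝ (Fin d) => L 1) hcomp).trans ?_
    exact congrArg (mfderiv (𝓘(ℝ, ℝ).prod (𝓡 d)) (𝓡 d) A (θ r, q r))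
      (congrArg (fun L : ℝ →L[ℝ] ℝ × EuclideanSpace ℝ (Fin d) => L 1) hpair)
  rw [hval]
  refine (map_add _ _ _).trans (congrArg₂ (· + ·) ?_ ?_)
  · have h4 : mfderiv 𝓘(ℝ, ℝ) (𝓡 d) (fun τ : ℝ => Circle.exp (2 * Real.pi * τ) • q r) (θ r) θ' =
        θ' • mfderiv 𝓘(ℝ, ℝ) (𝓡 d) (fun τ : ℝ => Circle.exp (2 * Real.pi * τ) • q r) (θ r)
          (1 : ℝ) := by
      let L : ℝ →L[ℝ] EuclideanSpace ℝ (Fin d) :=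
        mfderiv 𝓘(ℝ, ℝ) (𝓡 d) (fun τ : ℝ => Circle.exp (2 * Real.pi * τ) • q r) (θ r)
      exact (congrArg L (mul_one θ').symm).trans (L.map_smul θ' 1)
    rw [h4]
    refine (map_smul _ _ _).trans ?_
    exact (congrArg (θ' * ·) (hη.apply_mfderiv_exp_smul hπ (θ r) (q r))).trans (mul_one θ')
  · exact congrArg (fun L : EuclideanSpace ℝ (Fin d) →L[ℝ] ℝ =>
      L (mfderiv 𝓘(ℝ, ℝ) (𝓡 d) q r (1 : ℝ)))
      (congrFun (hη.invariant (Circle.exp (2 * Real.pi * θ r))) (q r))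

end Action

section Lifts

variable {k : ℝ} {Γ : Subgroup (SolGroup k)} [DiscreteTopology Γ]
  {d : ℕ} {M : Type*} [TopologicalSpace M] [ChartedSpace (EuclideanSpace ℝ (Fin d)) M]
  {π : M → SolGroup k ⧸ Γ}

/-- The form on `M` induced by a right invariant form on `G`, evaluated on the derivative of a map
whose projection lifts to `G`. -/
lemma pullback_descend_apply_mfderiv (hπ : ContMDiff (𝓡 d) (𝓡 3) ∞ π)
    {a : OneForm 3 (SolGroup k)}
    (ha : ∀ h : SolGroup k, OneForm.pullback (fun g => g * h) a = a)
    {E H X : Type*} [NormedAddCommGroup E] [NormedSpace ℝ E] [TopologicalSpace H]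
    {I : ModelWithCorners ℝ E H} [TopologicalSpace X] [ChartedSpace H X]
    {w : X → M} {u : X → SolGroup k} {x : X} (hw : MDifferentiableAt I (𝓡 d) w x)
    (hu : MDifferentiableAt I (𝓡 3) u x)
    (heq : ∀ᶠ x' in 𝓝 x, π (w x') = QuotientGroup.mk (u x')) (v : TangentSpace I x) :
    OneForm.pullback π (SolGroup.descend Γ a) (w x) (mfderiv I (𝓡 d) w x v) =
      a (u x) (mfderiv I (𝓡 3) u x v) := by
  have h1 := mfderiv_comp x ((hπ (w x)).mdifferentiableAt (by simp)) hw
  have h2 := mfderiv_comp x ((SolGroup.contMDiff_mk Γ (u x)).mdifferentiableAt (by simp)) hu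
  have h3 : mfderiv I (𝓡 3) (π ∘ w) x =
      mfderiv I (𝓡 3) ((QuotientGroup.mk : SolGroup k → SolGroup k ⧸ Γ) ∘ u) x :=
    Filter.EventuallyEq.mfderiv_eq heq
  have h4 := (h1.symm.trans h3).trans h2
  have h5 := (SolGroup.descend Γ a).apply_congr heq.self_of_nhds
    (mfderiv (𝓡 d) (𝓡 3) π (w x) (mfderiv I (𝓡 d) w x v))
  refine h5.trans ?_
  have h6 : (mfderiv (𝓡 d) (𝓡 3) π (w x) (mfderiv I (𝓡 d) w x v) : EuclideanSpace ℝ (Fin 3)) =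
      mfderiv (𝓡 3) (𝓡 3) (QuotientGroup.mk : SolGroup k → SolGroup k ⧸ Γ) (u x)
        (mfderiv I (𝓡 3) u x v) :=
    congrArg (fun L : E →L[ℝ] EuclideanSpace ℝ (Fin 3) => L v) h4
  refine (congrArg (SolGroup.descend Γ a (QuotientGroup.mk (u x))) h6).trans ?_
  exact congrArg (fun L : EuclideanSpace ℝ (Fin 3) →L[ℝ] ℝ => L (mfderiv I (𝓡 3) u x v))
    (congrFun (SolGroup.pullback_descend Γ a ha) (u x))

/-- Pull-back of an induced form under a map which covers a left translation. -/
lemma pullback_pullback_descend (hπ : ContMDiff (𝓡 d) (𝓡 3) ∞ π) {a b : OneForm 3 (SolGroup k)}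
    (ha : ∀ h : SolGroup k, OneForm.pullback (fun g => g * h) a = a)
    (hb : ∀ h : SolGroup k, OneForm.pullback (fun g => g * h) b = b)
    {h : SolGroup k} (hab : OneForm.pullback (fun g => h * g) a = b)
    {ψ : M → M} (hψ : ContMDiff (𝓡 d) (𝓡 d) ∞ ψ) (hψπ : ∀ p, π (ψ p) = h • π p) :
    OneForm.pullback (d := d) ψ (OneForm.pullback (d := d) π (SolGroup.descend Γ a)) =
      OneForm.pullback (d := d) π (SolGroup.descend Γ b) := by
  funext p
  refine ContinuousLinearMap.ext fun v => ?_
  let u : M → SolGroup k := fun q => SolGroup.localSection Γ (π p) (π q)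
  have hu : MDifferentiableAt (𝓡 d) (𝓡 3) u p :=
    ((SolGroup.contMDiffAt_localSection Γ (π p)).comp p (hπ p)).mdifferentiableAt (by simp)
  have hpu : ∀ᶠ q in 𝓝 p, π q = QuotientGroup.mk (u q) := by
    filter_upwards [(hπ.continuous.continuousAt (x := p)) ((SolGroup.localSection Γ
      (π p)).open_source.mem_nhds (SolGroup.mem_localSection_source Γ (π p)))] with q hq
    exact (SolGroup.mk_localSection Γ hq).symm
  have hL : MDifferentiableAt (𝓡 3) (𝓡 3) (fun g => h * g) (u p) :=
    (SolGroup.contMDiff_mul_left h (u p)).mdifferentiableAt (by simp)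
  have h1 := pullback_descend_apply_mfderiv hπ ha ((hψ p).mdifferentiableAt (by simp))
    (u := fun q => h * u q) (hL.comp p hu :)
    (hpu.mono fun q hq => by rw [hψπ, hq]; rfl) v
  have h2 := pullback_descend_apply_mfderiv hπ hb (w := id) mdifferentiableAt_id hu hpu v
  rw [mfderiv_id] at h2
  refine h1.trans (Eq.trans ?_ h2.symm)
  have h3 := mfderiv_comp p hL hu
  refine (congrArg (fun L : EuclideanSpace ℝ (Fin d) →L[ℝ] EuclideanSpace ℝ (Fin 3) =>
    (a (h * u p) : EuclideanSpace ℝ (Fin 3) →L[ℝ] ℝ) (L v)) h3).trans ?_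
  exact congrArg (fun L : EuclideanSpace ℝ (Fin 3) →L[ℝ] ℝ => L (mfderiv (𝓡 d) (𝓡 3) u p v))
    (congrFun hab (u p))

end Lifts

/-! ### Horizontal lifts of left translations -/

/-- A function which is smooth on an open set agrees near each point of it with a globally smooth
function. -/
lemma exists_contDiff_eq_on_ball {E F : Type*} [NormedAddCommGroup E] [InnerProductSpace ℝ E]
    [FiniteDimensional ℝ E] [NormedAddCommGroup F] [NormedSpace ℝ F] {f : E → F} {W : Set E}
    (hW : IsOpen W) (hf : ∀ y ∈ W, ContDiffAt ℝ ∞ f y) {x : E} (hx : x ∈ W) :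
    ∃ (f' : E → F) (δ : ℝ), ContDiff ℝ ∞ f' ∧ 0 < δ ∧ Metric.ball x δ ⊆ W ∧
      ∀ y ∈ Metric.ball x δ, f' y = f y := by
  obtain ⟨R, hR, hRW⟩ := Metric.nhds_basis_closedBall.mem_iff.1 (hW.mem_nhds hx)
  let φ : ContDiffBump x := ⟨R / 2, R, half_pos hR, half_lt_self hR⟩
  refine ⟨fun y => φ y • f y, R / 2, contDiff_iff_contDiffAt.2 fun y => ?_, half_pos hR,
    (Metric.ball_subset_ball (half_le_self hR.le)).trans (Metric.ball_subset_closedBall.trans hRW),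
    fun y hy => ?_⟩
  · by_cases hy : y ∈ Metric.closedBall x R
    · exact φ.contDiffAt.smul (hf y (hRW hy))
    · refine (contDiffAt_const (c := (0 : F))).congr_of_eventuallyEq ?_
      filter_upwards [Metric.isClosed_closedBall.isOpen_compl.mem_nhds hy] with z hz
      have hzR : R ≤ dist z x := by simpa using (not_le.1 fun h : dist z x ≤ R => hz h).le
      simp [φ.zero_of_le_dist hzR]
  · simp [φ.one_of_mem_closedBall (Metric.ball_subset_closedBall hy)]

/-- The values of four `1`-forms on a tangent vector. -/
def coframe {d : ℕ} {M : Type*} [TopologicalSpace M] [ChartedSpace (EuclideanSpace ℝ (Fin d)) M]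
    (α β γ η : OneForm d M) (p : M) : TangentSpace (𝓡 d) p →ₗ[ℝ] ℝ × ℝ × ℝ × ℝ :=
  (α p).toLinearMap.prod ((β p).toLinearMap.prod ((γ p).toLinearMap.prod (η p).toLinearMap))

section LocalFlow

variable {k : ℝ} {Γ : Subgroup (SolGroup k)} [DiscreteTopology Γ]
  {d : ℕ} {M : Type*} [TopologicalSpace M] [ChartedSpace (EuclideanSpace ℝ (Fin d)) M]
  [IsManifold (𝓡 d) ∞ M] [MulAction Circle M] {π : M → SolGroup k ⧸ Γ} {α β γ η : OneForm d M}

/-- The left translations by a one-parameter group of the form `(r a, r b, r c)` have horizontal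
lifts to the bundle, locally and for small times. -/
lemma exists_local_horizontal_flow (hπ : IsPrincipalCircleBundle (d := d) (e := 3) π)
    (hα : α = OneForm.pullback π (SolGroup.descend Γ (SolGroup.alpha k)))
    (hβ : β = OneForm.pullback π (SolGroup.descend Γ (SolGroup.beta k)))
    (hγ : γ = OneForm.pullback π (SolGroup.descend Γ (SolGroup.gamma k)))
    (hη : IsConnectionForm η) {a b c : ℝ} (hac : a * c = 0) (hbc : b * c = 0)
    (b₀ : SolGroup k ⧸ Γ) :
    ∃ (V : Set (SolGroup k ⧸ Γ)) (ε : ℝ) (Φ : ℝ × M → M), IsOpen V ∧ b₀ ∈ V ∧ 0 < ε ∧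
      ContMDiffOn (𝓘(ℝ, ℝ).prod (𝓡 d)) (𝓡 d) ∞ Φ (Set.Ioo (-ε) ε ×ˢ (π ⁻¹' V)) ∧
      ∀ p : M, π p ∈ V → Φ (0, p) = p ∧ ∀ r ∈ Set.Ioo (-ε) ε,
        π (Φ (r, p)) = (SolGroup.mk (r * a) (r * b) (r * c) : SolGroup k) • π p ∧
        coframe α β γ η (Φ (r, p))
          (mfderiv 𝓘(ℝ, ℝ) (𝓡 d) (fun r => Φ (r, p)) r (1 : ℝ)) = (a, b, c, 0) := by
  obtain ⟨τ, hb, hτ, hτs, hτe⟩ := hπ.exists_trivialization b₀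
  have hπs := hπ.contMDiff_proj
  let ℓ : OpenPartialHomeomorph (SolGroup k ⧸ Γ) (EuclideanSpace ℝ (Fin 3)) :=
    SolGroup.localSection Γ b₀
  let mk' : EuclideanSpace ℝ (Fin 3) → SolGroup k ⧸ Γ :=
    (QuotientGroup.mk : SolGroup k → SolGroup k ⧸ Γ)
  have hmk : ContMDiff 𝓘(ℝ, EuclideanSpace ℝ (Fin 3)) (𝓡 3) ∞ mk' := SolGroup.contMDiff_mk Γ
  let S : EuclideanSpace ℝ (Fin 3) → M := fun g => τ.toOpenPartialHomeomorph.symm (mk' g, 1)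
  let W : Set (EuclideanSpace ℝ (Fin 3)) := mk' ⁻¹' τ.baseSet
  have hW : IsOpen W := τ.open_baseSet.preimage hmk.continuous
  have hS : ∀ g ∈ W, ContMDiffAt 𝓘(ℝ, EuclideanSpace ℝ (Fin 3)) (𝓡 d) ∞ S g := fun g hg =>
    (hτs.contMDiffAt (τ.open_target.mem_nhds ((τ.mem_target (x := (mk' g, 1))).2 hg))).comp g
      ((hmk g).prodMk contMDiffAt_const)
  have hπS : ∀ g ∈ W, π (S g) = mk' g := fun g hg => τ.proj_symm_apply' hg
  have hτS : ∀ g ∈ W, τ (S g) = (mk' g, 1) := fun g hg => τ.apply_symm_apply' hg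
  clear_value S
  let h₀ : EuclideanSpace ℝ (Fin 3) → ℝ := fun g => η (S g)
    (mfderiv 𝓘(ℝ, EuclideanSpace ℝ (Fin 3)) (𝓡 d) S g (SolGroup.generator k a b c g))
  have hh₀ : ∀ g ∈ W, ContDiffAt ℝ ∞ h₀ g := fun g hg =>
    hη.smooth.contDiffAt_apply_mfderiv (hS g hg) (SolGroup.contDiff_generator a b c).contDiffAt
  let g₀ : EuclideanSpace ℝ (Fin 3) := ℓ b₀
  have hg₀ : g₀ ∈ W := by
    change (QuotientGroup.mk (SolGroup.localSection Γ b₀ b₀) : SolGroup k ⧸ Γ) ∈ τ.baseSet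
    rwa [SolGroup.mk_localSection Γ (SolGroup.mem_localSection_source Γ b₀)]
  obtain ⟨f, δ, hf, hδ, hδW, hfh⟩ := exists_contDiff_eq_on_ball hW hh₀ hg₀
  let L := SolGroup.translate k a b c
  have hL : ContDiff ℝ ∞ L := SolGroup.contDiff_translate a b c
  have hL0 : ∀ g, L (0, g) = g := SolGroup.translate_zero a b c
  have hpre : L ⁻¹' Metric.ball g₀ δ ∈ 𝓝 ((0 : ℝ), g₀) :=
    hL.continuous.continuousAt (Metric.isOpen_ball.mem_nhds (by rw [hL0]; exact Metric.mem_ball_self hδ))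
  obtain ⟨ε, hε, hεL⟩ := Metric.mem_nhds_iff.1 hpre
  have hLball : ∀ r ∈ Set.Ioo (-ε) ε, ∀ g ∈ Metric.ball g₀ ε, L (r, g) ∈ Metric.ball g₀ δ := by
    intro r hr g hg
    refine hεL ?_
    rw [← ball_prod_same]
    exact ⟨by simpa [abs_lt] using hr, hg⟩
  let θ : ℝ × EuclideanSpace ℝ (Fin 3) → ℝ := fun q => -∫ t in (0 : ℝ)..q.1, f (L (t, q.2))
  have hθ : ContDiff ℝ ∞ θ := (contDiff_primitive_of_contDiff (hf.comp hL)).neg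
  have hθd : ∀ r g, HasDerivAt (fun r => θ (r, g)) (-f (L (r, g))) r := fun r g =>
    ((hf.continuous.comp (hL.continuous.comp
      (by fun_prop : Continuous fun t : ℝ => (t, g)))).integral_hasStrictDerivAt 0 r).hasDerivAt.neg
  let V : Set (SolGroup k ⧸ Γ) := ℓ.source ∩ ℓ ⁻¹' (Metric.ball g₀ ε : Set (EuclideanSpace ℝ (Fin 3)))
  let Φ : ℝ × M → M := fun q => Circle.exp (2 * Real.pi * θ (q.1, ℓ (π q.2))) •
    ((τ q.2).2 • S (L (q.1, ℓ (π q.2))))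
  have hbase : ∀ p, π p ∈ V → mk' (ℓ (π p)) = π p := fun p hp => SolGroup.mk_localSection Γ hp.1
  have h0 : (0 : ℝ) ∈ Set.Ioo (-ε) ε := ⟨neg_lt_zero.2 hε, hε⟩
  have hLW : ∀ r ∈ Set.Ioo (-ε) ε, ∀ p, π p ∈ V → L (r, ℓ (π p)) ∈ W := fun r hr p hp =>
    hδW (hLball r hr _ hp.2)
  have hsrc : ∀ p, π p ∈ V → p ∈ τ.source := fun p hp => τ.mem_source.2 (by
    have := hLW 0 h0 p hp
    rw [hL0] at this
    rw [← hbase p hp]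
    exact this)
  refine ⟨V, ε, Φ, ℓ.isOpen_inter_preimage Metric.isOpen_ball,
    ⟨SolGroup.mem_localSection_source Γ b₀, Metric.mem_ball_self hε⟩, hε, ?_, ?_⟩
  · rintro ⟨r, p⟩ ⟨hr, hp⟩
    refine ContMDiffAt.contMDiffWithinAt ?_
    have hpV : π p ∈ V := hp
    have hℓ : ContMDiffAt (𝓡 3) 𝓘(ℝ, EuclideanSpace ℝ (Fin 3)) ∞ ℓ (π p) :=
      (contMDiffOn_chart (I := 𝓡 3) (x := b₀)).contMDiffAt
        ((chartAt (EuclideanSpace ℝ (Fin 3)) b₀).open_source.mem_nhds ⟨hpV.1, trivial⟩)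
    have hℓπ : ContMDiffAt (𝓡 d) 𝓘(ℝ, EuclideanSpace ℝ (Fin 3)) ∞ (fun q => ℓ (π q)) p :=
      hℓ.comp p (hπs p)
    have hg : ContMDiffAt (𝓘(ℝ, ℝ).prod (𝓡 d)) 𝓘(ℝ, ℝ × EuclideanSpace ℝ (Fin 3)) ∞
        (fun q : ℝ × M => (q.1, ℓ (π q.2))) (r, p) :=
      contMDiffAt_fst.prodMk_space (ContMDiffAt.comp (g := fun q => ℓ (π q)) (r, p) hℓπ contMDiffAt_snd)
    have hθ' : ContMDiffAt (𝓘(ℝ, ℝ).prod (𝓡 d)) 𝓘(ℝ, ℝ) ∞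
        (fun q : ℝ × M => θ (q.1, ℓ (π q.2))) (r, p) :=
      ContMDiffAt.comp (g := θ) (r, p) (hθ.contMDiff _) hg
    have hL' : ContMDiffAt (𝓘(ℝ, ℝ).prod (𝓡 d)) 𝓘(ℝ, EuclideanSpace ℝ (Fin 3)) ∞
        (fun q : ℝ × M => L (q.1, ℓ (π q.2))) (r, p) :=
      ContMDiffAt.comp (g := L) (r, p) (hL.contMDiff _) hg
    have hSL : ContMDiffAt (𝓘(ℝ, ℝ).prod (𝓡 d)) (𝓡 d) ∞
        (fun q : ℝ × M => S (L (q.1, ℓ (π q.2)))) (r, p) :=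
      ContMDiffAt.comp (g := S) (r, p) (hS _ (hLW r hr p hp)) hL'
    have hτp : ContMDiffAt (𝓡 d) ((𝓡 3).prod (𝓡 1)) ∞ τ p :=
      hτ.contMDiffAt (τ.open_source.mem_nhds (hsrc p hp))
    have hτ2 : ContMDiffAt (𝓘(ℝ, ℝ).prod (𝓡 d)) (𝓡 1) ∞ (fun q : ℝ × M => (τ q.2).2) (r, p) :=
      ContMDiffAt.comp (g := fun q => (τ q).2) (r, p) (contMDiffAt_snd.comp p hτp) contMDiffAt_snd
    have hin : ContMDiffAt (𝓘(ℝ, ℝ).prod (𝓡 d)) (𝓡 d) ∞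
        (fun q : ℝ × M => (τ q.2).2 • S (L (q.1, ℓ (π q.2)))) (r, p) :=
      ContMDiffAt.comp (g := fun q : Circle × M => q.1 • q.2) (r, p) (hπ.contMDiff_smul _)
        (hτ2.prodMk hSL)
    exact ContMDiffAt.comp (g := fun q : ℝ × M => Circle.exp (2 * Real.pi * q.1) • q.2) (r, p)
      (hπ.contMDiff_exp_smul _) (hθ'.prodMk hin)
  · intro p hp
    refine ⟨?_, fun r hr => ?_⟩
    · have hWp : ℓ (π p) ∈ W := by
        have := hLW 0 h0 p hp
        rwa [hL0] at this
      have hz : θ (0, ℓ (π p)) = 0 := by simp [θ]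
      have hSsrc : S (ℓ (π p)) ∈ τ.source := τ.mem_source.2 (by rw [hπS _ hWp]; exact hWp)
      have hmem : (τ p).2 • S (ℓ (π p)) ∈ τ.source :=
        τ.mem_source.2 (by rw [hπ.proj_smul, hπS _ hWp]; exact hWp)
      change Circle.exp (2 * Real.pi * θ (0, ℓ (π p))) • ((τ p).2 • S (L (0, ℓ (π p)))) = p
      rw [hz, mul_zero, Circle.exp_zero, one_smul, hL0]
      refine τ.injOn hmem (hsrc p hp) (Prod.ext ?_ ?_)
      · rw [τ.coe_coe, τ.coe_fst hmem, τ.coe_fst (hsrc p hp), hπ.proj_smul, hπS _ hWp, hbase p hp]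
      · rw [τ.coe_coe, hτe _ _ hSsrc, hτS _ hWp, mul_one]
    · let g : EuclideanSpace ℝ (Fin 3) := ℓ (π p)
      have hLr : HasDerivAt (fun r => L (r, g)) (SolGroup.generator k a b c (L (r, g))) r :=
        SolGroup.hasDerivAt_translate hac hbc r g
      have hLm : MDifferentiableAt 𝓘(ℝ, ℝ) 𝓘(ℝ, EuclideanSpace ℝ (Fin 3)) (fun r => L (r, g)) r :=
        hLr.differentiableAt.mdifferentiableAt
      have hSm := (hS _ (hLW r hr p hp)).mdifferentiableAt (by simp)
      have hSL : MDifferentiableAt 𝓘(ℝ, ℝ) (𝓡 d) (fun r => S (L (r, g))) r := hSm.comp r hLm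
      have hact : MDifferentiableAt (𝓡 d) (𝓡 d) (fun q : M => (τ p).2 • q) (S (L (r, g))) :=
        ((hπ.contMDiff_smul.comp (contMDiff_const.prodMk contMDiff_id)) _).mdifferentiableAt
          (by simp)
      have hq : MDifferentiableAt 𝓘(ℝ, ℝ) (𝓡 d) (fun r => (τ p).2 • S (L (r, g))) r :=
        hact.comp r hSL
      have hΦm : MDifferentiableAt 𝓘(ℝ, ℝ) (𝓡 d) (fun r => Φ (r, p)) r :=
        ((hπ.contMDiff_exp_smul _).mdifferentiableAt (by simp)).comp r
          (((hθd r g).differentiableAt.mdifferentiableAt).prodMk hq)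
      have hΦπ : ∀ᶠ t in 𝓝 r, π (Φ (t, p)) =
          QuotientGroup.mk (show SolGroup k from L (t, g)) := by
        filter_upwards [isOpen_Ioo.mem_nhds hr] with t ht
        exact (hπ.proj_smul _ _).trans ((hπ.proj_smul _ _).trans (hπS _ (hLW t ht p hp)))
      have hform : ∀ ν : OneForm 3 (SolGroup k),
          (∀ h : SolGroup k, OneForm.pullback (fun g => g * h) ν = ν) →
          OneForm.pullback π (SolGroup.descend Γ ν) (Φ (r, p))
            (mfderiv 𝓘(ℝ, ℝ) (𝓡 d) (fun r => Φ (r, p)) r (1 : ℝ)) =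
          ν (L (r, g)) (SolGroup.generator k a b c (L (r, g))) := fun ν hν =>
        (pullback_descend_apply_mfderiv hπs hν hΦm (u := fun t => L (t, g)) hLm hΦπ _).trans
          (congrArg (ν (L (r, g))) hLr.mfderiv_apply_one)
      refine ⟨hΦπ.self_of_nhds.trans ?_, Prod.ext ?_ (Prod.ext ?_ (Prod.ext ?_ ?_))⟩
      · rw [← hbase p hp]
        rfl
      · rw [hα]
        exact (hform _ SolGroup.pullback_mul_right_alpha).trans (SolGroup.alpha_generator a b c _)
      · rw [hβ]
        exact (hform _ SolGroup.pullback_mul_right_beta).trans (SolGroup.beta_generator a b c _)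
      · rw [hγ]
        exact (hform _ SolGroup.pullback_mul_right_gamma).trans (SolGroup.gamma_generator a b c _)
      · have h1 := hη.apply_mfderiv_curve hπ (hθd r g) hq
        have h2 := mfderiv_comp r hact hSL
        have h3 := mfderiv_comp r hSm hLm
        have h4 : (mfderiv 𝓘(ℝ, ℝ) (𝓡 d) (fun r => (τ p).2 • S (L (r, g))) r (1 : ℝ) :
            EuclideanSpace ℝ (Fin d)) =
            mfderiv (𝓡 d) (𝓡 d) (fun q : M => (τ p).2 • q) (S (L (r, g)))
              (mfderiv 𝓘(ℝ, EuclideanSpace ℝ (Fin 3)) (𝓡 d) S (L (r, g))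
                (SolGroup.generator k a b c (L (r, g)))) := by
          refine (congrArg (fun D : ℝ →L[ℝ] EuclideanSpace ℝ (Fin d) => D 1) h2).trans ?_
          refine congrArg (mfderiv (𝓡 d) (𝓡 d) (fun q : M => (τ p).2 • q) (S (L (r, g)))) ?_
          refine (congrArg (fun D : ℝ →L[ℝ] EuclideanSpace ℝ (Fin d) => D 1) h3).trans ?_
          exact congrArg (mfderiv 𝓘(ℝ, EuclideanSpace ℝ (Fin 3)) (𝓡 d) S (L (r, g)))
            hLr.mfderiv_apply_one
        have h5 : η ((τ p).2 • S (L (r, g)))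
            (mfderiv 𝓘(ℝ, ℝ) (𝓡 d) (fun r => (τ p).2 • S (L (r, g))) r (1 : ℝ)) =
            h₀ (L (r, g)) :=
          (congrArg (η ((τ p).2 • S (L (r, g)))) h4).trans
            (congrArg (fun D : EuclideanSpace ℝ (Fin d) →L[ℝ] ℝ =>
              D (mfderiv 𝓘(ℝ, EuclideanSpace ℝ (Fin 3)) (𝓡 d) S (L (r, g))
                (SolGroup.generator k a b c (L (r, g)))))
              (congrFun (hη.invariant (τ p).2) (S (L (r, g)))))
        refine h1.trans ((congrArg (fun s => -f (L (r, g)) + s) h5).trans ?_)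
        rw [hfh _ (hLball r hr g hp.2)]
        ring

end LocalFlow

section GlobalFlow

variable {k : ℝ} {Γ : Subgroup (SolGroup k)} [DiscreteTopology Γ]
  {M : Type*} [TopologicalSpace M] [ChartedSpace (EuclideanSpace ℝ (Fin 4)) M]
  [IsManifold (𝓡 4) ∞ M] [MulAction Circle M] {π : M → SolGroup k ⧸ Γ} {α β γ η : OneForm 4 M}

/-- The values of the four forms on the velocity of the circle action. -/
lemma exists_coframe_eq_vertical (hπ : IsPrincipalCircleBundle (d := 4) (e := 3) π)
    (hα : α = OneForm.pullback π (SolGroup.descend Γ (SolGroup.alpha k)))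
    (hβ : β = OneForm.pullback π (SolGroup.descend Γ (SolGroup.beta k)))
    (hγ : γ = OneForm.pullback π (SolGroup.descend Γ (SolGroup.gamma k)))
    (hη : IsConnectionForm η) (p : M) : ∃ v, coframe α β γ η p v = (0, 0, 0, 1) := by
  let w : ℝ → M := fun τ => Circle.exp (2 * Real.pi * τ) • p
  have hw : MDifferentiableAt 𝓘(ℝ, ℝ) (𝓡 4) w 0 :=
    ((hπ.contMDiff_exp_smul.comp (contMDiff_id.prodMk contMDiff_const)) 0).mdifferentiableAt
      (by simp)
  have hw0 : w 0 = p := by simp [w]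
  have hproj : ∀ᶠ t in 𝓝 (0 : ℝ), π (w t) = QuotientGroup.mk (π p).out :=
    Filter.Eventually.of_forall fun t => (hπ.proj_smul _ _).trans (QuotientGroup.out_eq' _).symm
  have hform : ∀ ν : OneForm 3 (SolGroup k),
      (∀ h : SolGroup k, OneForm.pullback (fun g => g * h) ν = ν) →
      OneForm.pullback π (SolGroup.descend Γ ν) (w 0)
        (mfderiv 𝓘(ℝ, ℝ) (𝓡 4) w 0 (1 : ℝ)) = 0 := by
    intro ν hν
    have h := pullback_descend_apply_mfderiv hπ.contMDiff_proj hν hw (u := fun _ => (π p).out)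
      mdifferentiableAt_const hproj (1 : ℝ)
    rw [mfderiv_const] at h
    exact h.trans (map_zero _)
  rw [← hw0]
  refine ⟨mfderiv 𝓘(ℝ, ℝ) (𝓡 4) w 0 (1 : ℝ), Prod.ext ?_ (Prod.ext ?_ (Prod.ext ?_ ?_))⟩
  · rw [hα]
    exact hform _ SolGroup.pullback_mul_right_alpha
  · rw [hβ]
    exact hform _ SolGroup.pullback_mul_right_beta
  · rw [hγ]
    exact hform _ SolGroup.pullback_mul_right_gamma
  · exact hη.vertical p

lemma exists_coframe_eq (hπ : IsPrincipalCircleBundle (d := 4) (e := 3) π)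
    (hα : α = OneForm.pullback π (SolGroup.descend Γ (SolGroup.alpha k)))
    (hβ : β = OneForm.pullback π (SolGroup.descend Γ (SolGroup.beta k)))
    (hγ : γ = OneForm.pullback π (SolGroup.descend Γ (SolGroup.gamma k)))
    (hη : IsConnectionForm η) {a b c : ℝ} (hac : a * c = 0) (hbc : b * c = 0) (p : M) :
    ∃ v, coframe α β γ η p v = (a, b, c, 0) := by
  obtain ⟨V, ε, Φ, -, hp, hε, -, hΦ⟩ := exists_local_horizontal_flow hπ hα hβ hγ hη hac hbc (π p)
  obtain ⟨h0, h1⟩ := hΦ p hp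
  have h2 := (h1 0 ⟨neg_lt_zero.2 hε, hε⟩).2
  rw [← h0]
  exact ⟨_, h2⟩

/-- The forms `α, β, γ, η` are a coframe. -/
lemma coframe_bijective (hπ : IsPrincipalCircleBundle (d := 4) (e := 3) π)
    (hα : α = OneForm.pullback π (SolGroup.descend Γ (SolGroup.alpha k)))
    (hβ : β = OneForm.pullback π (SolGroup.descend Γ (SolGroup.beta k)))
    (hγ : γ = OneForm.pullback π (SolGroup.descend Γ (SolGroup.gamma k)))
    (hη : IsConnectionForm η) (p : M) : Function.Bijective (coframe α β γ η p) := by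
  have hsurj : Function.Surjective (coframe α β γ η p) := by
    rintro ⟨a, b, c, e⟩
    obtain ⟨v₁, h₁⟩ := exists_coframe_eq hπ hα hβ hγ hη (a := a) (b := b) (c := 0)
      (by simp) (by simp) p
    obtain ⟨v₂, h₂⟩ := exists_coframe_eq hπ hα hβ hγ hη (a := 0) (b := 0) (c := c)
      (by simp) (by simp) p
    obtain ⟨v₃, h₃⟩ := exists_coframe_eq_vertical hπ hα hβ hγ hη p
    exact ⟨v₁ + v₂ + e • v₃, by simp [map_add, map_smul, h₁, h₂, h₃]⟩
  refine ⟨?_, hsurj⟩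
  let f : EuclideanSpace ℝ (Fin 4) →ₗ[ℝ] ℝ × ℝ × ℝ × ℝ := coframe α β γ η p
  have hdim : Module.finrank ℝ (EuclideanSpace ℝ (Fin 4)) = Module.finrank ℝ (ℝ × ℝ × ℝ × ℝ) := by
    simp
  exact (LinearMap.injective_iff_surjective_of_finrank_eq_finrank (f := f) hdim).2 hsurj

/-- Left translations by a one-parameter group of the form `(r a, r b, r c)` lift to a horizontal
flow on the bundle. -/
theorem exists_horizontal_flow [CompactSpace (SolGroup k ⧸ Γ)] [T2Space M]
    (hπ : IsPrincipalCircleBundle (d := 4) (e := 3) π)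
    (hα : α = OneForm.pullback π (SolGroup.descend Γ (SolGroup.alpha k)))
    (hβ : β = OneForm.pullback π (SolGroup.descend Γ (SolGroup.beta k)))
    (hγ : γ = OneForm.pullback π (SolGroup.descend Γ (SolGroup.gamma k)))
    (hη : IsConnectionForm η) {a b c : ℝ} (hac : a * c = 0) (hbc : b * c = 0) :
    ∃ Ψ : ℝ → M → M, IsSmoothFlow (d := 4) Ψ ∧
      (∀ r p, π (Ψ r p) = (SolGroup.mk (r * a) (r * b) (r * c) : SolGroup k) • π p) ∧
      ∀ r p, coframe α β γ η (Ψ r p)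
        (mfderiv 𝓘(ℝ, ℝ) (𝓡 4) (fun r => Ψ r p) r (1 : ℝ)) = (a, b, c, 0) := by
  have hloc := exists_local_horizontal_flow hπ hα hβ hγ hη hac hbc
  choose V εV Φ hVo hVmem hεV hΦs hΦ using hloc
  have hπc : Continuous π := hπ.contMDiff_proj.continuous
  have hinj := fun p => (coframe_bijective hπ hα hβ hγ hη p).1
  choose v hv using fun p : M => exists_coframe_eq hπ hα hβ hγ hη hac hbc p
  have hvΦ : ∀ (b₀ : SolGroup k ⧸ Γ) (p : M), π p ∈ V b₀ → ∀ r ∈ Set.Ioo (-εV b₀) (εV b₀),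
      mfderiv 𝓘(ℝ, ℝ) (𝓡 4) (fun r => Φ b₀ (r, p)) r (1 : ℝ) = v (Φ b₀ (r, p)) :=
    fun b₀ p hp r hr => hinj _ ((((hΦ b₀ p hp).2 r hr).2).trans (hv _).symm)
  have hΦat : ∀ (b₀ : SolGroup k ⧸ Γ) (p : M), π p ∈ V b₀ → ∀ r ∈ Set.Ioo (-εV b₀) (εV b₀),
      ContMDiffAt (𝓘(ℝ, ℝ).prod (𝓡 4)) (𝓡 4) ∞ (Φ b₀) (r, p) := fun b₀ p hp r hr =>
    (hΦs b₀).contMDiffAt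
      ((isOpen_Ioo.prod ((hVo b₀).preimage hπc)).mem_nhds ⟨hr, hp⟩)
  have hΦm : ∀ (b₀ : SolGroup k ⧸ Γ) (p : M), π p ∈ V b₀ → ∀ r ∈ Set.Ioo (-εV b₀) (εV b₀),
      HasMFDerivAt 𝓘(ℝ, ℝ) (𝓡 4) (fun r => Φ b₀ (r, p)) r
        ((1 : ℝ →L[ℝ] ℝ).smulRight (v (Φ b₀ (r, p)))) := by
    intro b₀ p hp r hr
    have hm : MDifferentiableAt 𝓘(ℝ, ℝ) (𝓡 4) (fun r => Φ b₀ (r, p)) r :=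
      (ContMDiffAt.comp (g := Φ b₀) r (hΦat b₀ p hp r hr)
        (contMDiffAt_id.prodMk contMDiffAt_const)).mdifferentiableAt (by simp)
    have heq : (mfderiv 𝓘(ℝ, ℝ) (𝓡 4) (fun r => Φ b₀ (r, p)) r : ℝ →L[ℝ] EuclideanSpace ℝ (Fin 4)) =
        (1 : ℝ →L[ℝ] ℝ).smulRight (v (Φ b₀ (r, p)) : EuclideanSpace ℝ (Fin 4)) := by
      refine ContinuousLinearMap.ext_ring ((hvΦ b₀ p hp r hr).trans ?_)
      exact (one_smul ℝ (v (Φ b₀ (r, p)) : EuclideanSpace ℝ (Fin 4))).symm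
    exact heq ▸ hm.hasMFDerivAt
  have hvs : ContMDiff (𝓡 4) (𝓡 4).tangent 1
      (fun p => (⟨p, v p⟩ : TangentBundle (𝓡 4) M)) := by
    intro p
    let f : M → ℝ → M := fun x r => Φ (π p) (r, x)
    have h0 : (0 : ℝ) ∈ Set.Ioo (-εV (π p)) (εV (π p)) :=
      ⟨neg_lt_zero.2 (hεV (π p)), hεV (π p)⟩
    have hΦp := hΦat (π p) p (hVmem (π p)) 0 h0
    have hf : ContMDiffAt ((𝓡 4).prod 𝓘(ℝ, ℝ)) (𝓡 4) ∞ (Function.uncurry f) (p, 0) :=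
      ContMDiffAt.comp (g := Φ (π p)) (f := fun q : M × ℝ => (q.2, q.1)) (p, (0 : ℝ)) hΦp
        (contMDiffAt_snd.prodMk contMDiffAt_fst)
    have hf0 : ContMDiffAt (𝓡 4) (𝓡 4) 1 (fun x => f x 0) p :=
      ContMDiffAt.comp (g := Φ (π p)) (f := fun q : M => ((0 : ℝ), q)) p
        (hΦp.of_le (by simp)) (contMDiffAt_const.prodMk contMDiffAt_id)
    have hone : ContMDiffAt (𝓡 4) (𝓘(ℝ, ℝ)).tangent 1
        (fun _ : M => (⟨(0 : ℝ), (1 : ℝ)⟩ : TangentBundle 𝓘(ℝ, ℝ) ℝ)) p := contMDiffAt_const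
    have h11 : (1 : WithTop ℕ∞) + 1 ≤ ∞ := by
      rw [one_add_one_eq_two]
      exact WithTop.coe_le_coe.2 (le_top : (2 : ℕ∞) ≤ ⊤)
    have h1 := ContMDiffAt.mfderiv (m := 1) f (fun _ => (0 : ℝ)) hf contMDiffAt_const h11
    have h2 := ContMDiffAt.clm_apply_of_inCoordinates (b₁ := fun _ : M => (0 : ℝ))
      (b₂ := fun x => f x 0) (ϕ := fun x => mfderiv 𝓘(ℝ, ℝ) (𝓡 4) (f x) (0 : ℝ))
      (v := fun _ => (1 : ℝ)) h1 hone hf0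
    refine h2.congr_of_eventuallyEq ?_
    filter_upwards [((hVo (π p)).preimage hπc).mem_nhds (hVmem (π p))] with x hx
    have h3 : f x 0 = x := (hΦ (π p) x hx).1
    have h4 : mfderiv 𝓘(ℝ, ℝ) (𝓡 4) (f x) 0 (1 : ℝ) = v (f x 0) := hvΦ (π p) x hx 0 h0
    exact (congrArg (fun y => (⟨y, v y⟩ : TangentBundle (𝓡 4) M)) h3).symm.trans
      (congrArg (fun e => (⟨f x 0, e⟩ : TangentBundle (𝓡 4) M)) h4).symm
  obtain ⟨t, ht⟩ := CompactSpace.elim_nhds_subcover V fun b => (hVo b).mem_nhds (hVmem b)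
  have hcover : ∀ p : M, ∃ b₀ ∈ t, π p ∈ V b₀ := fun p => by
    have : π p ∈ ⋃ x ∈ t, V x := ht ▸ trivial
    simpa using this
  obtain ⟨ε, hεt, hε⟩ : ∃ ε : ℝ, (∀ b ∈ t, ε < εV b) ∧ 0 < ε := by
    have h1 : ∀ᶠ ε in 𝓝[>] (0 : ℝ), ∀ b ∈ t, ε < εV b :=
      (Filter.eventually_all_finset t).2 fun b _ =>
        Filter.mem_of_superset (Ioo_mem_nhdsGT (hεV b)) fun x hx => hx.2
    exact (h1.and self_mem_nhdsWithin).exists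
  have hsub : ∀ b ∈ t, Set.Ioo (-ε) ε ⊆ Set.Ioo (-εV b) (εV b) := fun b hb =>
    Set.Ioo_subset_Ioo (neg_le_neg (hεt b hb).le) (hεt b hb).le
  obtain ⟨Ψ, hΨ, hΨint⟩ := exists_flow_of_uniform_local_flow hvs hε fun p₀ => by
    obtain ⟨b₀, hb₀, hp₀⟩ := hcover p₀
    refine ⟨π ⁻¹' V b₀, Φ b₀, (hVo b₀).preimage hπc, hp₀,
      (hΦs b₀).mono (Set.prod_mono (hsub b₀ hb₀) subset_rfl), fun p hp =>
      ⟨(hΦ b₀ p hp).1, fun r hr => ?_⟩⟩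
    exact (hΦm b₀ p hp r (hsub b₀ hb₀ hr)).hasMFDerivWithinAt
  refine ⟨Ψ, hΨ, ?_, fun r p => ?_⟩
  · let h : ℝ → SolGroup k := fun r => SolGroup.mk (r * a) (r * b) (r * c)
    have hadd : ∀ r s, h (r + s) = h r * h s := by
      intro r s
      rcases mul_eq_zero.1 hac with ha | hc
      · rcases mul_eq_zero.1 hbc with hb | hc
        · subst ha hb
          exact SolGroup.ext_coords (by simp [h]) (by simp [h]) (by simp [h]; ring)
        · subst ha hc
          exact SolGroup.ext_coords (by simp [h]) (by simp [h]; ring) (by simp [h])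
      · subst hc
        exact SolGroup.ext_coords (by simp [h]; ring) (by simp [h]; ring) (by simp [h])
    have hsmall : ∀ r ∈ Set.Ioo (-ε) ε, ∀ p, π (Ψ r p) = h r • π p := by
      intro r hr p
      obtain ⟨b₀, hb₀, hp⟩ := hcover p
      have hΦint : IsMIntegralCurveOn (fun r => Φ b₀ (r, p)) v (Set.Ioo (-ε) ε) := fun r hr =>
        (hΦm b₀ p hp r (hsub b₀ hb₀ hr)).hasMFDerivWithinAt
      have : Ψ r p = Φ b₀ (r, p) :=
        isMIntegralCurveOn_Ioo_eqOn_of_contMDiff_boundaryless (t₀ := 0)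
          ⟨neg_lt_zero.2 hε, hε⟩ hvs ((hΨint p).isMIntegralCurveOn _) hΦint
          ((hΨ.map_zero p).trans (hΦ b₀ p hp).1.symm) hr
      rw [this]
      exact ((hΦ b₀ p hp).2 r (hsub b₀ hb₀ hr)).1
    have hn : ∀ (n : ℕ), ∀ r ∈ Set.Ioo (-ε) ε, ∀ p, π (Ψ (n * r) p) = h (n * r) • π p := by
      intro n r hr p
      induction n with
      | zero => simpa [hΨ.map_zero] using hsmall 0 ⟨neg_lt_zero.2 hε, hε⟩ p
      | succ n ih =>
        have : ((n + 1 : ℕ) : ℝ) * r = r + n * r := by push_cast; ring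
        rw [this, hΨ.map_add, hsmall r hr, ih, hadd, mul_smul]
    intro r p
    obtain ⟨n, hn'⟩ := exists_nat_gt (|r| / ε)
    have hn0 : (0 : ℝ) < n := (div_nonneg (abs_nonneg r) hε.le).trans_lt hn'
    have hr : r / n ∈ Set.Ioo (-ε) ε := by
      rw [Set.mem_Ioo, ← abs_lt, abs_div, abs_of_pos hn0, div_lt_iff₀ hn0]
      rwa [div_lt_iff₀ hε, mul_comm] at hn'
    have := hn n (r / n) hr p
    rwa [mul_div_cancel₀ r hn0.ne'] at this
  · have h1 : mfderiv 𝓘(ℝ, ℝ) (𝓡 4) (fun r => Ψ r p) r (1 : ℝ) = v (Ψ r p) :=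
      (congrArg (fun D : ℝ →L[ℝ] EuclideanSpace ℝ (Fin 4) => D 1) (hΨint p r).mfderiv).trans
        (one_smul ℝ (v (Ψ r p) : EuclideanSpace ℝ (Fin 4)))
    rw [h1]
    exact hv _

end GlobalFlow

/-! ### The action of flows on forms -/

section FlowForms

variable {d : ℕ} {M : Type*} [TopologicalSpace M] [ChartedSpace (EuclideanSpace ℝ (Fin d)) M]

lemma exists_curve_mfderiv_eq [IsManifold (𝓡 d) ∞ M] (p : M) (v : EuclideanSpace ℝ (Fin d)) :
    ∃ q : ℝ → M, q 0 = p ∧ ContMDiffAt 𝓘(ℝ, ℝ) (𝓡 d) ∞ q 0 ∧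
      mfderiv 𝓘(ℝ, ℝ) (𝓡 d) q 0 (1 : ℝ) = v := by
  have : IsManifold (𝓡 d) 1 M := IsManifold.of_le (n := ∞) (by simp)
  let y : EuclideanSpace ℝ (Fin d) := extChartAt (𝓡 d) p p
  let ℓ : ℝ → EuclideanSpace ℝ (Fin d) := fun u => y + u • v
  have hℓ : HasDerivAt ℓ v 0 :=
    (((hasDerivAt_id (0 : ℝ)).smul_const v).const_add y).congr_deriv (one_smul ℝ v)
  have hℓ0 : ℓ 0 = y := by simp [ℓ]
  have hs : ContMDiffAt 𝓘(ℝ, EuclideanSpace ℝ (Fin d)) (𝓡 d) ∞ (extChartAt (𝓡 d) p).symm y :=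
    (contMDiffOn_extChartAt_symm p).contMDiffAt (extChartAt_target_mem_nhds p)
  have hℓs : ContMDiffAt 𝓘(ℝ, ℝ) 𝓘(ℝ, EuclideanSpace ℝ (Fin d)) ∞ ℓ 0 :=
    (by fun_prop : ContDiff ℝ ∞ ℓ).contMDiff.contMDiffAt
  refine ⟨(extChartAt (𝓡 d) p).symm ∘ ℓ, ?_, hs.comp_of_eq hℓs hℓ0, ?_⟩
  · simp [hℓ0, y]
  · have h1 := mfderiv_comp_of_eq (hs.mdifferentiableAt (by simp))
      (hℓs.mdifferentiableAt (by simp)) hℓ0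
    have h2 := mfderivWithin_range_extChartAt_symm (I := 𝓡 d) (x := p)
    rw [ModelWithCorners.range_eq_univ, mfderivWithin_univ] at h2
    let D : EuclideanSpace ℝ (Fin d) → EuclideanSpace ℝ (Fin d) →L[ℝ] EuclideanSpace ℝ (Fin d) :=
      fun x => mfderiv 𝓘(ℝ, EuclideanSpace ℝ (Fin d)) (𝓡 d) (extChartAt (𝓡 d) p).symm x
    have h3 : D (ℓ 0) v = v := by
      rw [hℓ0]
      exact congrArg (fun L : EuclideanSpace ℝ (Fin d) →L[ℝ] EuclideanSpace ℝ (Fin d) => L v) h2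
    refine (congrArg (fun L : ℝ →L[ℝ] EuclideanSpace ℝ (Fin d) => L 1) h1).trans ?_
    exact (congrArg (D (ℓ 0)) hℓ.mfderiv_apply_one).trans h3

/-- Cartan's formula: the derivative of the pull-backs of a form under a flow whose velocity is
annihilated by the form. -/
lemma OneForm.IsSmooth.hasDerivAt_pullback_flow [IsManifold (𝓡 d) ∞ M] {a : OneForm d M}
    (ha : a.IsSmooth)
    {Ψ : ℝ → M → M} (hΨ : IsSmoothFlow (d := d) Ψ)
    (h0 : ∀ r p, a (Ψ r p) (mfderiv 𝓘(ℝ, ℝ) (𝓡 d) (fun r => Ψ r p) r (1 : ℝ)) = 0)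
    (p : M) (v : TangentSpace (𝓡 d) p) (r : ℝ) :
    HasDerivAt (fun r => OneForm.pullback (Ψ r) a p v)
      (a.extDeriv (Ψ r p) (mfderiv 𝓘(ℝ, ℝ) (𝓡 d) (fun r => Ψ r p) r (1 : ℝ))
        (mfderiv (𝓡 d) (𝓡 d) (Ψ r) p v)) r := by
  obtain ⟨q, hq0, hq, hqv⟩ := exists_curve_mfderiv_eq p v
  let w : ℝ × ℝ → M := fun x => Ψ x.1 (q x.2)
  have hw : ∀ r, ContMDiffAt 𝓘(ℝ, ℝ × ℝ) (𝓡 d) ∞ w (r, 0) := fun r =>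
    ContMDiffAt.comp (g := fun x : ℝ × M => Ψ x.1 x.2) (f := fun x : ℝ × ℝ => (x.1, q x.2))
      (r, (0 : ℝ)) (hΨ.contMDiff _)
      (contDiff_fst.contMDiff.contMDiffAt.prodMk
        (ContMDiffAt.comp (g := q) (f := fun x : ℝ × ℝ => x.2) (r, (0 : ℝ)) hq
          contDiff_snd.contMDiff.contMDiffAt))
  have hpartial₁ : ∀ x : ℝ × ℝ, MDifferentiableAt 𝓘(ℝ, ℝ × ℝ) (𝓡 d) w x →
      mfderiv 𝓘(ℝ, ℝ × ℝ) (𝓡 d) w x ((1, 0) : ℝ × ℝ) =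
        mfderiv 𝓘(ℝ, ℝ) (𝓡 d) (fun r => Ψ r (q x.2)) x.1 (1 : ℝ) := by
    intro x hx
    have hl : HasDerivAt (fun r' : ℝ => (r', x.2)) ((1, 0) : ℝ × ℝ) x.1 :=
      (hasDerivAt_id x.1).prodMk (hasDerivAt_const x.1 x.2)
    have h1 := mfderiv_comp (g := w) x.1 hx hl.differentiableAt.mdifferentiableAt
    exact ((congrArg (fun L : ℝ →L[ℝ] EuclideanSpace ℝ (Fin d) => L 1) h1).trans
      (congrArg (mfderiv 𝓘(ℝ, ℝ × ℝ) (𝓡 d) w x) hl.mfderiv_apply_one)).symm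
  have hpartial₂ : ∀ r, mfderiv 𝓘(ℝ, ℝ × ℝ) (𝓡 d) w (r, 0) ((0, 1) : ℝ × ℝ) =
      mfderiv (𝓡 d) (𝓡 d) (Ψ r) p v := by
    intro r
    have hl : HasDerivAt (fun u : ℝ => (r, u)) ((0, 1) : ℝ × ℝ) 0 :=
      (hasDerivAt_const (0 : ℝ) r).prodMk (hasDerivAt_id (0 : ℝ))
    have h1 := mfderiv_comp (g := w) (0 : ℝ) ((hw r).mdifferentiableAt (by simp))
      hl.differentiableAt.mdifferentiableAt
    have h2 := mfderiv_comp (g := Ψ r) (0 : ℝ)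
      ((hΨ.contMDiff_apply r (q 0)).mdifferentiableAt (by simp)) (hq.mdifferentiableAt (by simp))
    have h3 := (congrArg (fun L : ℝ →L[ℝ] EuclideanSpace ℝ (Fin d) => L 1) h1).trans
      (congrArg (mfderiv 𝓘(ℝ, ℝ × ℝ) (𝓡 d) w (r, 0)) hl.mfderiv_apply_one)
    have h4 := (congrArg (fun L : ℝ →L[ℝ] EuclideanSpace ℝ (Fin d) => L 1) h2).trans
      (congrArg (mfderiv (𝓡 d) (𝓡 d) (Ψ r) (q 0)) hqv)
    refine (h3.symm.trans h4).trans ?_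
    exact congrArg (fun y : M => (mfderiv (𝓡 d) (𝓡 d) (Ψ r) y :
      EuclideanSpace ℝ (Fin d) →L[ℝ] EuclideanSpace ℝ (Fin d)) v) hq0
  have hwp : ∀ r, w (r, 0) = Ψ r p := fun r => congrArg (Ψ r) hq0
  have hev : ∀ᶠ x in 𝓝 (r, (0 : ℝ)),
      a (w x) (mfderiv 𝓘(ℝ, ℝ × ℝ) (𝓡 d) w x ((1, 0) : ℝ × ℝ)) = 0 := by
    filter_upwards [(contMDiffAt_iff_contMDiffAt_nhds (by simp)).1
      ((hw r).of_le (by simp : (1 : WithTop ℕ∞) ≤ ∞))] with x hx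
    rw [hpartial₁ x (hx.mdifferentiableAt (by simp))]
    exact h0 x.1 (q x.2)
  have hmain := ha.hasDerivAt_apply_mfderiv (hw r) hev
  rw [hpartial₁ _ ((hw r).mdifferentiableAt (by simp)), hpartial₂] at hmain
  have hfun : (fun r' => a (w (r', 0))
      (mfderiv 𝓘(ℝ, ℝ × ℝ) (𝓡 d) w (r', 0) ((0, 1) : ℝ × ℝ))) =
      fun r => OneForm.pullback (Ψ r) a p v := by
    funext r'
    rw [hpartial₂]
    exact a.apply_congr (hwp r') _
  rw [hfun] at hmain
  convert hmain using 1
  have key : ∀ p' : M, p' = p → ∀ V : EuclideanSpace ℝ (Fin d),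
      a.extDeriv (Ψ r p) (mfderiv 𝓘(ℝ, ℝ) (𝓡 d) (fun r => Ψ r p) r (1 : ℝ)) V =
      a.extDeriv (Ψ r p') (mfderiv 𝓘(ℝ, ℝ) (𝓡 d) (fun r => Ψ r p') r (1 : ℝ)) V := by
    rintro p' rfl V
    rfl
  exact key (q 0) hq0 _

lemma OneForm.pullback_comp {f g : M → M} (hf : ContMDiff (𝓡 d) (𝓡 d) ∞ f)
    (hg : ContMDiff (𝓡 d) (𝓡 d) ∞ g) (a : OneForm d M) :
    OneForm.pullback (d := d) (f ∘ g) a = OneForm.pullback g (OneForm.pullback (d := d) f a) := by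
  funext p
  refine ContinuousLinearMap.ext fun v => ?_
  have h := mfderiv_comp p ((hf (g p)).mdifferentiableAt (by simp))
    ((hg p).mdifferentiableAt (by simp))
  exact congrArg (fun L : EuclideanSpace ℝ (Fin d) →L[ℝ] EuclideanSpace ℝ (Fin d) =>
    (a (f (g p)) : EuclideanSpace ℝ (Fin d) →L[ℝ] ℝ) (L v)) h

lemma OneForm.pullback_add (f : M → M) (a b : OneForm d M) :
    OneForm.pullback (d := d) f (a + b) = OneForm.pullback f a + OneForm.pullback f b := rfl

lemma OneForm.pullback_sub (f : M → M) (a b : OneForm d M) :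
    OneForm.pullback (d := d) f (a - b) = OneForm.pullback f a - OneForm.pullback f b := rfl

lemma OneForm.pullback_smul (f : M → M) (c : ℝ) (a : OneForm d M) :
    OneForm.pullback (d := d) f (c • a) = c • OneForm.pullback f a := rfl

lemma IsSmoothFlow.pullback_zero {Ψ : ℝ → M → M} (hΨ : IsSmoothFlow (d := d) Ψ)
    (a : OneForm d M) : OneForm.pullback (Ψ 0) a = a := by
  have h : Ψ 0 = id := funext hΨ.map_zero
  rw [h]
  funext p
  refine ContinuousLinearMap.ext fun v => ?_
  simp [OneForm.pullback]

end FlowForms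

section Bundle

variable {k : ℝ} {Γ : Subgroup (SolGroup k)} [DiscreteTopology Γ]
  {M : Type*} [TopologicalSpace M] [ChartedSpace (EuclideanSpace ℝ (Fin 4)) M]
  [MulAction Circle M] {π : M → SolGroup k ⧸ Γ} {α β γ η : OneForm 4 M}

/-- The induced forms under a map which covers a left translation. -/
lemma pullback_of_covers_mul_left (hπ : IsPrincipalCircleBundle (d := 4) (e := 3) π)
    (hα : α = OneForm.pullback π (SolGroup.descend Γ (SolGroup.alpha k)))
    (hβ : β = OneForm.pullback π (SolGroup.descend Γ (SolGroup.beta k)))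
    (hγ : γ = OneForm.pullback π (SolGroup.descend Γ (SolGroup.gamma k)))
    {ψ : M → M} (hψ : ContMDiff (𝓡 4) (𝓡 4) ∞ ψ) {h : SolGroup k}
    (hψπ : ∀ p, π (ψ p) = h • π p) :
    OneForm.pullback ψ α = Real.exp (k * h.z) • α - (k * h.x) • γ ∧
    OneForm.pullback ψ β = Real.exp (-(k * h.z)) • β + (k * h.y) • γ ∧
    OneForm.pullback ψ γ = γ := by
  have hπs := hπ.contMDiff_proj
  subst hα hβ hγ
  refine ⟨?_, ?_, ?_⟩
  · refine pullback_pullback_descend hπs SolGroup.pullback_mul_right_alpha (fun g => ?_)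
      (SolGroup.pullback_mul_left_alpha h) hψ hψπ
    rw [OneForm.pullback_sub, OneForm.pullback_smul, OneForm.pullback_smul,
      SolGroup.pullback_mul_right_alpha, SolGroup.pullback_mul_right_gamma]
  · refine pullback_pullback_descend hπs SolGroup.pullback_mul_right_beta (fun g => ?_)
      (SolGroup.pullback_mul_left_beta h) hψ hψπ
    rw [OneForm.pullback_add, OneForm.pullback_smul, OneForm.pullback_smul,
      SolGroup.pullback_mul_right_beta, SolGroup.pullback_mul_right_gamma]
  · exact pullback_pullback_descend hπs SolGroup.pullback_mul_right_gamma
      SolGroup.pullback_mul_right_gamma (SolGroup.pullback_mul_left_gamma h) hψ hψπ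

/-- The derivative of the pull-backs of the connection form under a horizontal flow. -/
lemma hasDerivAt_pullback_connection [IsManifold (𝓡 4) ∞ M] (hη : IsConnectionForm η) {C : ℝ}
    (hcurv : η.extDeriv = C • α.wedge β) {Ψ : ℝ → M → M} (hΨ : IsSmoothFlow (d := 4) Ψ)
    {a b c : ℝ} (hvel : ∀ r p, coframe α β γ η (Ψ r p)
      (mfderiv 𝓘(ℝ, ℝ) (𝓡 4) (fun r => Ψ r p) r (1 : ℝ)) = (a, b, c, 0))
    (p : M) (v : TangentSpace (𝓡 4) p) (r : ℝ) :
    HasDerivAt (fun r => OneForm.pullback (Ψ r) η p v)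
      (C * (a * OneForm.pullback (Ψ r) β p v - b * OneForm.pullback (Ψ r) α p v)) r := by
  have h := hη.smooth.hasDerivAt_pullback_flow hΨ
    (fun r p => congrArg (fun x : ℝ × ℝ × ℝ × ℝ => x.2.2.2) (hvel r p)) p v r
  rw [hcurv] at h
  refine h.congr_deriv ?_
  have h1 : α (Ψ r p) (mfderiv 𝓘(ℝ, ℝ) (𝓡 4) (fun r => Ψ r p) r (1 : ℝ)) = a :=
    congrArg (fun x : ℝ × ℝ × ℝ × ℝ => x.1) (hvel r p)
  have h2 : β (Ψ r p) (mfderiv 𝓘(ℝ, ℝ) (𝓡 4) (fun r => Ψ r p) r (1 : ℝ)) = b :=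
    congrArg (fun x : ℝ × ℝ × ℝ × ℝ => x.2.1) (hvel r p)
  exact congrArg₂ (fun x y => C * (x * β (Ψ r p) (mfderiv (𝓡 4) (𝓡 4) (Ψ r) p v) -
    y * α (Ψ r p) (mfderiv (𝓡 4) (𝓡 4) (Ψ r) p v))) h1 h2

lemma eq_add_mul_of_hasDerivAt_const {f : ℝ → ℝ} {m : ℝ} (hf : ∀ r, HasDerivAt f m r) (r : ℝ) :
    f r = f 0 + r * m := by
  have hg : ∀ r, HasDerivAt (fun r => f r - r * m) 0 r := fun r =>
    ((hf r).sub ((hasDerivAt_id r).mul_const m)).congr_deriv (by simp)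
  have := is_const_of_deriv_eq_zero (fun r => (hg r).differentiableAt)
    (fun r => (hg r).deriv) r 0
  simp only [zero_mul, sub_zero] at this
  linarith

variable [IsManifold (𝓡 4) ∞ M] [T2Space M] [CompactSpace (SolGroup k ⧸ Γ)]

/-- The horizontal flow along the `x`-direction. -/
lemma exists_flow_x (hπ : IsPrincipalCircleBundle (d := 4) (e := 3) π)
    (hα : α = OneForm.pullback π (SolGroup.descend Γ (SolGroup.alpha k)))
    (hβ : β = OneForm.pullback π (SolGroup.descend Γ (SolGroup.beta k)))
    (hγ : γ = OneForm.pullback π (SolGroup.descend Γ (SolGroup.gamma k)))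
    (hη : IsConnectionForm η) {C : ℝ} (hcurv : η.extDeriv = C • α.wedge β) :
    ∃ Ψ : ℝ → M → M, IsSmoothFlow (d := 4) Ψ ∧ ∀ r,
      OneForm.pullback (Ψ r) α = α - (k * r) • γ ∧ OneForm.pullback (Ψ r) β = β ∧
      OneForm.pullback (Ψ r) γ = γ ∧ OneForm.pullback (Ψ r) η = η + (C * r) • β := by
  obtain ⟨Ψ, hΨ, hcov, hvel⟩ := exists_horizontal_flow hπ hα hβ hγ hη (a := 1) (b := 0) (c := 0)
    (by simp) (by simp)
  have hform := fun r => pullback_of_covers_mul_left hπ hα hβ hγ (hΨ.contMDiff_apply r) (hcov r)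
  simp only [SolGroup.x_mk, SolGroup.y_mk, SolGroup.z_mk, mul_zero, neg_zero, Real.exp_zero,
    one_smul, mul_one, zero_smul, add_zero] at hform
  refine ⟨Ψ, hΨ, fun r => ⟨(hform r).1, (hform r).2.1, (hform r).2.2, ?_⟩⟩
  funext p
  refine ContinuousLinearMap.ext fun v => ?_
  have hd : ∀ r, HasDerivAt (fun r => OneForm.pullback (Ψ r) η p v) (C * β p v) r := fun r =>
    (hasDerivAt_pullback_connection hη hcurv hΨ hvel p v r).congr_deriv (by
      rw [(hform r).2.1]
      ring)
  refine (eq_add_mul_of_hasDerivAt_const hd r).trans ?_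
  rw [hΨ.pullback_zero]
  change _ = η p v + (C * r) * β p v
  ring

/-- The horizontal flow along the `y`-direction. -/
lemma exists_flow_y (hπ : IsPrincipalCircleBundle (d := 4) (e := 3) π)
    (hα : α = OneForm.pullback π (SolGroup.descend Γ (SolGroup.alpha k)))
    (hβ : β = OneForm.pullback π (SolGroup.descend Γ (SolGroup.beta k)))
    (hγ : γ = OneForm.pullback π (SolGroup.descend Γ (SolGroup.gamma k)))
    (hη : IsConnectionForm η) {C : ℝ} (hcurv : η.extDeriv = C • α.wedge β) :
    ∃ Ψ : ℝ → M → M, IsSmoothFlow (d := 4) Ψ ∧ ∀ r,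
      OneForm.pullback (Ψ r) β = β - (-k * r) • γ ∧ OneForm.pullback (Ψ r) α = α ∧
      OneForm.pullback (Ψ r) γ = γ ∧ OneForm.pullback (Ψ r) η = η + (-C * r) • α := by
  obtain ⟨Ψ, hΨ, hcov, hvel⟩ := exists_horizontal_flow hπ hα hβ hγ hη (a := 0) (b := 1) (c := 0)
    (by simp) (by simp)
  have hform := fun r => pullback_of_covers_mul_left hπ hα hβ hγ (hΨ.contMDiff_apply r) (hcov r)
  simp only [SolGroup.x_mk, SolGroup.y_mk, SolGroup.z_mk, mul_zero, neg_zero, Real.exp_zero,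
    one_smul, mul_one, zero_smul, sub_zero] at hform
  refine ⟨Ψ, hΨ, fun r => ⟨(hform r).2.1.trans ?_, (hform r).1, (hform r).2.2, ?_⟩⟩
  · funext p
    refine ContinuousLinearMap.ext fun v => ?_
    change β p v + (k * r) * γ p v = β p v - (-k * r) * γ p v
    ring
  funext p
  refine ContinuousLinearMap.ext fun v => ?_
  have hd : ∀ r, HasDerivAt (fun r => OneForm.pullback (Ψ r) η p v) (-C * α p v) r := fun r =>
    (hasDerivAt_pullback_connection hη hcurv hΨ hvel p v r).congr_deriv (by
      rw [(hform r).1]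
      ring)
  refine (eq_add_mul_of_hasDerivAt_const hd r).trans ?_
  rw [hΨ.pullback_zero]
  change _ = η p v + (-C * r) * α p v
  ring

/-- The horizontal flow along the `z`-direction. -/
lemma exists_flow_z (hπ : IsPrincipalCircleBundle (d := 4) (e := 3) π)
    (hα : α = OneForm.pullback π (SolGroup.descend Γ (SolGroup.alpha k)))
    (hβ : β = OneForm.pullback π (SolGroup.descend Γ (SolGroup.beta k)))
    (hγ : γ = OneForm.pullback π (SolGroup.descend Γ (SolGroup.gamma k)))
    (hη : IsConnectionForm η) {C : ℝ} (hcurv : η.extDeriv = C • α.wedge β) :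
    ∃ Ψ : ℝ → M → M, IsSmoothFlow (d := 4) Ψ ∧ ∀ r,
      OneForm.pullback (Ψ r) α = Real.exp (k * r) • α ∧
      OneForm.pullback (Ψ r) β = Real.exp (-(k * r)) • β ∧
      OneForm.pullback (Ψ r) γ = γ ∧ OneForm.pullback (Ψ r) η = η := by
  obtain ⟨Ψ, hΨ, hcov, hvel⟩ := exists_horizontal_flow hπ hα hβ hγ hη (a := 0) (b := 0) (c := 1)
    (by simp) (by simp)
  have hform := fun r => pullback_of_covers_mul_left hπ hα hβ hγ (hΨ.contMDiff_apply r) (hcov r)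
  simp only [SolGroup.x_mk, SolGroup.y_mk, SolGroup.z_mk, mul_zero, mul_one, zero_smul, add_zero,
    sub_zero] at hform
  refine ⟨Ψ, hΨ, fun r => ⟨(hform r).1, (hform r).2.1, (hform r).2.2, ?_⟩⟩
  funext p
  refine ContinuousLinearMap.ext fun v => ?_
  have hd : ∀ r, HasDerivAt (fun r => OneForm.pullback (Ψ r) η p v) 0 r := fun r =>
    (hasDerivAt_pullback_connection hη hcurv hΨ hvel p v r).congr_deriv (by ring)
  refine (eq_add_mul_of_hasDerivAt_const hd r).trans ?_
  rw [hΨ.pullback_zero, mul_zero, add_zero]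

end Bundle

/-! ### The isotopies -/

section Isotopy

variable {d : ℕ} {M : Type*} [TopologicalSpace M] [ChartedSpace (EuclideanSpace ℝ (Fin d)) M]
  {α β γ η : OneForm d M}

lemma OneForm.wedge_apply (a b : OneForm d M) (p : M) (v w : TangentSpace (𝓡 d) p) :
    a.wedge b p v w = a p v * b p w - b p v * a p w := rfl

lemma OmegaS_eq_OmegaT (c k s₁ s₂ s₃ : ℝ) :
    OmegaS α β γ η c k s₁ s₂ s₃ = OmegaT β α γ η (-c) (-k) s₁ s₂ s₃ := by
  funext p
  refine LinearMap.ext₂ fun v w => ?_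
  change s₁ * (β.wedge η p v w) + s₂ * (α.wedge γ p v w) +
      s₃ * (c * (α.wedge β p v w) + k * (γ.wedge η p v w)) =
    s₁ * (β.wedge η p v w) + s₂ * (α.wedge γ p v w) +
      s₃ * (-c * (β.wedge α p v w) - -k * (γ.wedge η p v w))
  simp only [OneForm.wedge_apply]
  ring

/-- A diffeomorphism which shears the coframe brings `OmegaT` into diagonal form. -/
lemma pullback_OmegaT {φ : M → M} {c k e x t₁ b t₃ : ℝ} (he : 0 < e)
    (hα : OneForm.pullback φ α = e • α - (k * x) • γ)
    (hβ : OneForm.pullback φ β = e⁻¹ • β) (hγ : OneForm.pullback φ γ = γ)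
    (hη : OneForm.pullback φ η = η + (c * x * e⁻¹) • β)
    (hx : t₃ = -(t₁ * x)) (hb : b - t₁ * k * c * x ^ 2 = e ^ 2) (p : M) :
    TwoForm.pullback φ (OmegaT α β γ η c k t₁ b t₃) p = e • (t₁ • α.wedge η + β.wedge γ) p := by
  refine LinearMap.ext₂ fun v w => ?_
  have hα' : ∀ v : TangentSpace (𝓡 d) p, α (φ p) (mfderiv (𝓡 d) (𝓡 d) φ p v) =
      e * α p v - (k * x) * γ p v := fun v =>
    congrArg (fun a : OneForm d M => a p v) hα
  have hβ' : ∀ v : TangentSpace (𝓡 d) p, β (φ p) (mfderiv (𝓡 d) (𝓡 d) φ p v) =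
      e⁻¹ * β p v := fun v => congrArg (fun a : OneForm d M => a p v) hβ
  have hγ' : ∀ v : TangentSpace (𝓡 d) p, γ (φ p) (mfderiv (𝓡 d) (𝓡 d) φ p v) = γ p v :=
    fun v => congrArg (fun a : OneForm d M => a p v) hγ
  have hη' : ∀ v : TangentSpace (𝓡 d) p, η (φ p) (mfderiv (𝓡 d) (𝓡 d) φ p v) =
      η p v + (c * x * e⁻¹) * β p v := fun v => congrArg (fun a : OneForm d M => a p v) hη
  let A := fun v => α (φ p) (mfderiv (𝓡 d) (𝓡 d) φ p v)
  let B := fun v => β (φ p) (mfderiv (𝓡 d) (𝓡 d) φ p v)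
  let G := fun v => γ (φ p) (mfderiv (𝓡 d) (𝓡 d) φ p v)
  let H := fun v => η (φ p) (mfderiv (𝓡 d) (𝓡 d) φ p v)
  change t₁ * (A v * H w - H v * A w) + b * (B v * G w - G v * B w) +
      t₃ * (c * (A v * B w - B v * A w) - k * (G v * H w - H v * G w)) =
    e * (t₁ * (α p v * η p w - η p v * α p w) + (β p v * γ p w - γ p v * β p w))
  simp only [A, B, G, H, hα', hβ', hγ', hη']
  have hee : e * e⁻¹ = 1 := mul_inv_cancel₀ he.ne'
  have hb' : b = e ^ 2 + t₁ * k * c * x ^ 2 := by linarith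
  subst hx hb'
  generalize e⁻¹ = i at hee
  have hi : e ^ 2 * i = e := by rw [pow_two, mul_assoc, hee, mul_one]
  linear_combination (β p v * γ p w - γ p v * β p w) * hi

/-- Along the admissible parameters the coefficient of the diagonalized form stays positive. -/
lemma coefficient_pos {t₁ t₃ u c k s t : ℝ} (hs : s ∈ Set.Icc (0 : ℝ) 1)
    (h : ∀ s ∈ Set.Icc (0 : ℝ) 1, t₁ * Real.exp (u * t) ≠ c * k * s * t₃ ^ 2) :
    0 < Real.exp (u * t) - k * c * (s * t₃) ^ 2 / t₁ := by
  have he : 0 < Real.exp (u * t) := Real.exp_pos _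
  have ht₁ : t₁ ≠ 0 := by
    rintro rfl
    exact h 0 ⟨le_rfl, zero_le_one⟩ (by simp)
  by_contra! hneg
  set m : ℝ := k * c * t₃ ^ 2 / t₁ with hm
  have hs2 : s ^ 2 ≤ 1 := by nlinarith [hs.1, hs.2]
  have h1 : Real.exp (u * t) ≤ m * s ^ 2 := by
    have : k * c * (s * t₃) ^ 2 / t₁ = m * s ^ 2 := by rw [hm]; ring
    linarith
  have hmpos : 0 < m := by
    by_contra! hm0
    nlinarith [sq_nonneg s]
  refine h (Real.exp (u * t) / m) ⟨by positivity, ?_⟩ ?_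
  · rw [div_le_one hmpos]
    nlinarith
  · have : c * k * t₃ ^ 2 = m * t₁ := by rw [hm]; field_simp
    calc t₁ * Real.exp (u * t) = (m * t₁) * (Real.exp (u * t) / m) := by field_simp
      _ = c * k * (Real.exp (u * t) / m) * t₃ ^ 2 := by rw [← this]; ring

/-- The isotopy obtained from a flow which shears the coframe and a flow which scales it. -/
theorem exists_isotopy {k c : ℝ} (hk : k ≠ 0) {X Z : ℝ → M → M} (hX : IsSmoothFlow (d := d) X)
    (hZ : IsSmoothFlow (d := d) Z)
    (hXf : ∀ r, OneForm.pullback (X r) α = α - (k * r) • γ ∧ OneForm.pullback (X r) β = β ∧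
      OneForm.pullback (X r) γ = γ ∧ OneForm.pullback (X r) η = η + (c * r) • β)
    (hZf : ∀ r, OneForm.pullback (Z r) α = Real.exp (k * r) • α ∧
      OneForm.pullback (Z r) β = Real.exp (-(k * r)) • β ∧
      OneForm.pullback (Z r) γ = γ ∧ OneForm.pullback (Z r) η = η)
    {t₁ t₂ t₃ u : ℝ} (ht₂ : t₂ = Real.exp u)
    (h : ∀ s ∈ Set.Icc (0 : ℝ) 1, ∀ t ∈ Set.Icc (0 : ℝ) 1,
      t₁ * Real.exp (u * t) ≠ c * k * s * t₃ ^ 2) :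
    ∃ (φ : ℝ → ℝ → (M ≃ₘ^∞⟮𝓡 d, 𝓡 d⟯ M)) (f : ℝ → ℝ → M → ℝ), IsSmoothIsotopy φ f ∧
      (∀ s ∈ Set.Icc (0 : ℝ) 1, ∀ t ∈ Set.Icc (0 : ℝ) 1, ∀ p : M,
        TwoForm.pullback (φ s t) (OmegaT α β γ η c k t₁ (Real.exp (u * t)) (s * t₃)) p =
          f s t p • (t₁ • α.wedge η + β.wedge γ) p) ∧
      ∀ p : M, TwoForm.pullback (φ 1 1) (OmegaT α β γ η c k t₁ t₂ t₃) p =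
        f 1 1 p • (t₁ • α.wedge η + β.wedge γ) p := by
  have ht₁ : t₁ ≠ 0 := by
    rintro rfl
    exact h 0 ⟨le_rfl, zero_le_one⟩ 0 ⟨le_rfl, zero_le_one⟩ (by simp)
  let B : ℝ → ℝ → ℝ := fun s t => Real.exp (u * t) - k * c * (s * t₃) ^ 2 / t₁
  have hB : ∀ s ∈ Set.Icc (0 : ℝ) 1, ∀ t ∈ Set.Icc (0 : ℝ) 1, 0 < B s t := fun s hs t ht =>
    coefficient_pos hs fun s' hs' => h s' hs' t ht
  let x : ℝ → ℝ := fun s => -(s * t₃) / t₁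
  let z : ℝ → ℝ → ℝ := fun s t => Real.log (B s t) / (2 * k)
  let φ : ℝ → ℝ → (M ≃ₘ^∞⟮𝓡 d, 𝓡 d⟯ M) := fun s t =>
    (hZ.diffeo (z s t)).trans (hX.diffeo (x s))
  let f : ℝ → ℝ → M → ℝ := fun s t _ => Real.exp (k * z s t)
  have hφ : ∀ s t, (φ s t : M → M) = X (x s) ∘ Z (z s t) := fun s t => rfl
  have hmain : ∀ s ∈ Set.Icc (0 : ℝ) 1, ∀ t ∈ Set.Icc (0 : ℝ) 1, ∀ p : M,
      TwoForm.pullback (φ s t) (OmegaT α β γ η c k t₁ (Real.exp (u * t)) (s * t₃)) p =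
        f s t p • (t₁ • α.wedge η + β.wedge γ) p := by
    intro s hs t ht p
    obtain ⟨hX1, hX2, hX3, hX4⟩ := hXf (x s)
    obtain ⟨hZ1, hZ2, hZ3, hZ4⟩ := hZf (z s t)
    have hcomp : ∀ a : OneForm d M, OneForm.pullback (φ s t) a =
        OneForm.pullback (Z (z s t)) (OneForm.pullback (d := d) (X (x s)) a) := fun a =>
      OneForm.pullback_comp (hX.contMDiff_apply _) (hZ.contMDiff_apply _) a
    refine pullback_OmegaT (x := x s) (Real.exp_pos _) ?_ ?_ ?_ ?_ ?_ ?_ p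
    · rw [hcomp, hX1, OneForm.pullback_sub, OneForm.pullback_smul, hZ1, hZ3]
    · rw [hcomp, hX2, hZ2, Real.exp_neg]
    · rw [hcomp, hX3, hZ3]
    · rw [hcomp, hX4, OneForm.pullback_add, OneForm.pullback_smul, hZ4, hZ2, Real.exp_neg]
      funext p
      refine ContinuousLinearMap.ext fun v => ?_
      change η p v + (c * x s) * ((Real.exp (k * z s t))⁻¹ * β p v) =
        η p v + (c * x s * (Real.exp (k * z s t))⁻¹) * β p v
      ring
    · simp only [x]
      field_simp
    · have h1 : Real.exp (k * z s t) ^ 2 = B s t := by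
        rw [← Real.exp_nat_mul]
        have : ((2 : ℕ) : ℝ) * (k * z s t) = Real.log (B s t) := by
          simp only [z]
          push_cast
          field_simp
        rw [this, Real.exp_log (hB s hs t ht)]
      rw [h1]
      simp only [B, x]
      field_simp
  have hxs : ContDiff ℝ ∞ (fun q : ℝ × ℝ => x q.1) := by
    simp only [x]
    fun_prop
  have hBs : ContDiff ℝ ∞ (fun q : ℝ × ℝ => B q.1 q.2) := by
    simp only [B]
    fun_prop
  have hzs : ContDiffOn ℝ ∞ (fun q : ℝ × ℝ => z q.1 q.2) (Set.Icc 0 1 ×ˢ Set.Icc 0 1) :=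
    (hBs.contDiffOn.log fun q hq => (hB q.1 hq.1 q.2 hq.2).ne').div_const _
  have hfst : ContMDiffOn (𝓘(ℝ, ℝ × ℝ).prod (𝓡 d)) 𝓘(ℝ, ℝ × ℝ) ∞ (Prod.fst : (ℝ × ℝ) × M → ℝ × ℝ)
      ((Set.Icc 0 1 ×ˢ Set.Icc 0 1) ×ˢ Set.univ) := contMDiffOn_fst
  have hmaps : Set.MapsTo (Prod.fst : (ℝ × ℝ) × M → ℝ × ℝ)
      ((Set.Icc 0 1 ×ˢ Set.Icc 0 1) ×ˢ Set.univ) (Set.Icc 0 1 ×ˢ Set.Icc 0 1) := fun q hq => hq.1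
  have hzM : ContMDiffOn (𝓘(ℝ, ℝ × ℝ).prod (𝓡 d)) 𝓘(ℝ, ℝ) ∞
      (fun q : (ℝ × ℝ) × M => z q.1.1 q.1.2) ((Set.Icc 0 1 ×ˢ Set.Icc 0 1) ×ˢ Set.univ) :=
    ContMDiffOn.comp (g := fun q : ℝ × ℝ => z q.1 q.2) hzs.contMDiffOn hfst hmaps
  have hxM : ContMDiffOn (𝓘(ℝ, ℝ × ℝ).prod (𝓡 d)) 𝓘(ℝ, ℝ) ∞
      (fun q : (ℝ × ℝ) × M => x q.1.1) ((Set.Icc 0 1 ×ˢ Set.Icc 0 1) ×ˢ Set.univ) :=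
    ContMDiffOn.comp (g := fun q : ℝ × ℝ => x q.1) hxs.contDiffOn.contMDiffOn hfst hmaps
  refine ⟨φ, f, ⟨?_, ?_, fun s _ t _ p => (Real.exp_pos _).ne', ?_⟩, hmain, fun p => ?_⟩
  · have h1 : ContMDiffOn (𝓘(ℝ, ℝ × ℝ).prod (𝓡 d)) (𝓡 d) ∞
        (fun q : (ℝ × ℝ) × M => Z (z q.1.1 q.1.2) q.2)
        ((Set.Icc 0 1 ×ˢ Set.Icc 0 1) ×ˢ Set.univ) :=
      hZ.contMDiff.comp_contMDiffOn (hzM.prodMk contMDiffOn_snd)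
    exact hX.contMDiff.comp_contMDiffOn (hxM.prodMk h1)
  · have h1 : ContDiff ℝ ∞ (fun r : ℝ => Real.exp (k * r)) := by fun_prop
    exact h1.contMDiff.comp_contMDiffOn hzM
  · refine Diffeomorph.ext fun p => ?_
    change X (x 0) (Z (z 0 0) p) = p
    have hx0 : x 0 = 0 := by simp [x]
    have hz0 : z 0 0 = 0 := by simp [z, B]
    rw [hx0, hz0, hX.map_zero, hZ.map_zero]
  · have h1 := hmain 1 ⟨zero_le_one, le_rfl⟩ 1 ⟨zero_le_one, le_rfl⟩ p
    rwa [mul_one, one_mul, ← ht₂] at h1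

end Isotopy

end

theorem theorem2
    (k : ℝ) (hk : ∃ m : ℤ, m ≠ 2 ∧ Real.exp k + Real.exp (-k) = m)
    (Γ : Subgroup (SolGroup k)) [DiscreteTopology Γ] [CompactSpace (SolGroup k ⧸ Γ)]
    (n : ℤ) (hn : n ≠ 0) (lam : ℝ)
    {M : Type*} [TopologicalSpace M] [T2Space M]
    [ChartedSpace (EuclideanSpace ℝ (Fin 4)) M] [IsManifold (𝓡 4) ∞ M] [MulAction Circle M]
    (π : M → SolGroup k ⧸ Γ) (hπ : IsPrincipalCircleBundle (d := 4) (e := 3) π)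
    (α β γ η : OneForm 4 M)
    (hα : α = OneForm.pullback π (SolGroup.descend Γ (SolGroup.alpha k)))
    (hβ : β = OneForm.pullback π (SolGroup.descend Γ (SolGroup.beta k)))
    (hγ : γ = OneForm.pullback π (SolGroup.descend Γ (SolGroup.gamma k)))
    (hη : IsConnectionForm η) (hcurv : η.extDeriv = (n * lam) • α.wedge β) :
    (∀ t₁ t₂ t₃ u : ℝ, t₂ = Real.exp u →
      (∀ s ∈ Set.Icc (0 : ℝ) 1, ∀ t ∈ Set.Icc (0 : ℝ) 1,
        t₁ * Real.exp (u * t) ≠ n * k * lam * s * t₃ ^ 2) →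
      ∃ (φ : ℝ → ℝ → (M ≃ₘ^∞⟮𝓡 4, 𝓡 4⟯ M)) (f : ℝ → ℝ → M → ℝ), IsSmoothIsotopy φ f ∧
        (∀ s ∈ Set.Icc (0 : ℝ) 1, ∀ t ∈ Set.Icc (0 : ℝ) 1, ∀ p : M,
          TwoForm.pullback (φ s t)
              (OmegaT α β γ η (n * lam) k t₁ (Real.exp (u * t)) (s * t₃)) p =
            f s t p • (t₁ • α.wedge η + β.wedge γ) p) ∧
        ∀ p : M, TwoForm.pullback (φ 1 1) (OmegaT α β γ η (n * lam) k t₁ t₂ t₃) p =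
          f 1 1 p • (t₁ • α.wedge η + β.wedge γ) p) ∧
    (∀ s₁ s₂ s₃ u : ℝ, s₂ = Real.exp u →
      (∀ s ∈ Set.Icc (0 : ℝ) 1, ∀ t ∈ Set.Icc (0 : ℝ) 1,
        s₁ * Real.exp (u * t) ≠ n * k * lam * s * s₃ ^ 2) →
      ∃ (φ : ℝ → ℝ → (M ≃ₘ^∞⟮𝓡 4, 𝓡 4⟯ M)) (f : ℝ → ℝ → M → ℝ), IsSmoothIsotopy φ f ∧
        (∀ s ∈ Set.Icc (0 : ℝ) 1, ∀ t ∈ Set.Icc (0 : ℝ) 1, ∀ p : M,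
          TwoForm.pullback (φ s t)
              (OmegaS α β γ η (n * lam) k s₁ (Real.exp (u * t)) (s * s₃)) p =
            f s t p • (s₁ • β.wedge η + α.wedge γ) p) ∧
        ∀ p : M, TwoForm.pullback (φ 1 1) (OmegaS α β γ η (n * lam) k s₁ s₂ s₃) p =
          f 1 1 p • (s₁ • β.wedge η + α.wedge γ) p) := by
  obtain ⟨m, hm2, hm⟩ := hk
  have hk0 : k ≠ 0 := by
    rintro rfl
    refine hm2 ?_
    have h2 : (m : ℝ) = 2 := by rw [← hm]; norm_num
    exact_mod_cast h2
  obtain ⟨X, hX, hXf⟩ := exists_flow_x hπ hα hβ hγ hη hcurv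
  obtain ⟨Y, hY, hYf⟩ := exists_flow_y hπ hα hβ hγ hη hcurv
  obtain ⟨Z, hZ, hZf⟩ := exists_flow_z hπ hα hβ hγ hη hcurv
  refine ⟨fun t₁ t₂ t₃ u ht₂ h => ?_, fun s₁ s₂ s₃ u hs₂ h => ?_⟩
  · refine exists_isotopy hk0 hX hZ hXf hZf ht₂ fun s hs t ht => ?_
    convert h s hs t ht using 1
    ring
  · simp only [OmegaS_eq_OmegaT]
    refine exists_isotopy (neg_ne_zero.2 hk0) hY hZ hYf (fun r => ?_) hs₂ fun s hs t ht => ?_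
    · obtain ⟨h1, h2, h3, h4⟩ := hZf r
      exact ⟨by rw [h2, neg_mul], by rw [h1, neg_mul, neg_neg], h3, h4⟩
    · convert h s hs t ht using 1
      ring
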